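/- Let $d,q\ge 1$, and equip $\mathbb R_+^d=[0,\infty)^d$ with its usual topology and the sup-norm metric. For $v\in\mathbb R_+^d$ let $v^{(1)}\ge\dots\ge v^{(d)}$ be its ordered coordinates; for $1\le i\le d$ put $\mathbb{CA}_d^{(i-1)}=\{v\in\mathbb R_+^d: v^{(i)}=0\}$ and $\mathbb E_d^{(i)}=\mathbb R_+^d\setminus\mathbb{CA}_d^{(i-1)}$. *Regular variation.* A random vector $V\in\mathbb R_+^d$ belongs to $\mathcal{MRV}(\alpha,b,\mu,\mathbb E_d^{(i)})$, where $\alpha\ge 0$, if $b$ is regularly varying at infinity with index $1/\alpha$ (index $\infty$ if $\alpha=0$), $\mu$ is a non-zero Borel measure on $\mathbb E_d^{(i)}$ that is finite on Borel sets at positive distance from $\mathbb{CA}_d^{(i-1)}$, and $t\,\mathbf E[f(V/b(t))]\to\int f\,d\mu$ as $t\to\infty$ for every bounded continuous real function $f$ whose support is at positive distance from $\mathbb{CA}_d^{(i-1)}$. The canonical scaling function is $b_i(t)=\inf\{x\in\mathbb R:\mathbf P(V^{(i)}\le x)\ge 1-1/t\}$. *Matrices.* For $A\in\mathbb R_+^{q\times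 d}$, $1\le k\le q$, $1\le i\le d$, put $\tau^{(k,i)}(A)=\sup_{z\in\mathbb E_d^{(i)}}(Az)^{(k)}/z^{(i)}\in[0,\infty]$ and $i_k(A)=\max\{j\in\{1,\dots,d\}:\tau^{(k,j)}(A)<\infty\}$. For $C\subseteq\mathbb R_+^q$ put $A^{-1}(C)=\{z\in\mathbb R_+^d: Az\in C\}$. *Assumptions.* Let $Z$ be a random vector in $\mathbb R_+^d$ with $Z\in\mathcal{MRV}(\alpha_i,b_i,\mu_i,\mathbb E_d^{(i)})$ for all $i=1,\dots,d$, where $b_i$ is the canonical scaling function for $Z$, and let $b_i(t)/b_{i+1}(t)\to\infty$ as $t\to\infty$ for $i=1,\dots,d-1$. Let $A$ be a random matrix in $\mathbb R_+^{q\times d}$, independent of $Z$, almost surely without zero rows; write $A_\omega=A(\omega)$. Fix $k\in\{1,\dots,q\}$, let $\Omega_i^{(k)}=\{\omega: i_k(A_\omega)=i\}$ and $\mathbf E_i^{(k)}[\,\cdot\,]=\mathbf E[\,\cdot\,\mathbf 1_{\Omega_i^{(k)}}]$. Let $C\subseteq\mathbb E_q^{(k)}$ be a Borel set at positive distance from $\mathbb{CA}_q^{(k-1)}$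 with $\mathbf E_i^{(k)}[\mu_i(\partial A^{-1}(C))]=0$ for all $i$ (that is, $\mu_i(\partial A_\omega^{-1}(C))=0$ for almost all $\omega\in\Omega_i^{(k)}$; the boundary is taken in $\mathbb R_+^d$). Suppose that for every $i=1,\dots,d$: (i) $\mathbf E_i^{(k)}[\tau^{(k,i)}(A)^{\alpha_i+\delta}]<\infty$ for some $\delta=\delta(i,k)>0$; (ii) for every $J\subseteq\{1,\dots,d\}$ with $|J|=i$, $\mu_i(\{v\in\mathbb R_+^d: v_j>0 \text{ for } j\in J,\ v_j=0\text{ for } j\notin J\})>0$. *Claim.* Let $i_k^*=\min\{i:\mathbf P(\Omega_i^{(k)})>0\}$ and $$\bar\iota=\min\bigl\{d,\ \inf\{i\in\{i_k^*,\dots,d\}:\mathbf E_i^{(k)}[\mu_i(A^{-1}(C))]>0\}\bigr\},\qquad \inf\emptyset=\infty .$$ If $A_\omega^{-1}(C)=\emptyset$ for all $\omega\in\Omega_i^{(k)}$ and all $i$ with $i_k^*\le i<\bar\iota$, then $\mathbf E_{\bar\iota}^{(k)}[\mu_{\bar\iota}(A^{-1}(C))]<\infty$ and $$\mathbf P(AZ\in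 tC)=\mathbf P(Z^{(\bar\iota)}>t)\,\mathbf E_{\bar\iota}^{(k)}[\mu_{\bar\iota}(A^{-1}(C))]+o\bigl(\mathbf P(Z^{(\bar\iota)}>t)\bigr),\qquad t\to\infty .$$ -/

import Mathlib

open MeasureTheory ProbabilityTheory Filter Topology Asymptotics
open scoped NNReal ENNReal Pointwise BoundedContinuousFunction Matrix

noncomputable section

namespace HiddenRV

/-! The orthant `[0, ∞)^d` is `Fin d → ℝ≥0`; its topology is the usual one and its metric is the
sup-norm metric. Indices in `{1, …, d}` are represented by `Fin d`, so `i : Fin d` stands for the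
index `i + 1`. -/

/-- The entrywise (product) measurable structure on matrices. -/
instance instMeasurableSpaceMatrix {m n S : Type*} [MeasurableSpace S] :
    MeasurableSpace (Matrix m n S) :=
  inferInstanceAs (MeasurableSpace (m → n → S))

/-- The `i`-th largest coordinate of `v` (the largest one for `i = 0`). -/
def orderStat {d : ℕ} {S : Type*} [LinearOrder S] (v : Fin d → S) (i : Fin d) : S :=
  v (Tuple.sort v i.rev)

/-- The union of the coordinate subspaces of dimension `i` (with `i` counted from `0`) of the
orthant: the vectors whose `(i + 1)`-st largest coordinate is zero, that is, the vectors with at most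
`i` positive coordinates. -/
def coordPlanes {d : ℕ} (i : Fin d) : Set (Fin d → ℝ≥0) :=
  {v | orderStat v i = 0}

/-- The subcone of the vectors whose `i`-th largest coordinate is positive: the orthant without
`coordPlanes i`. -/
def subcone {d : ℕ} (i : Fin d) : Set (Fin d → ℝ≥0) :=
  (coordPlanes i)ᶜ

/-- The open face of the orthant on which exactly the coordinates in `J` are positive. -/
def openFace {d : ℕ} (J : Finset (Fin d)) : Set (Fin d → ℝ≥0) :=
  {v | ∀ j, 0 < v j ↔ j ∈ J}

/-- `B` has positive distance from `C₀`. -/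
def BoundedAway {X : Type*} [PseudoMetricSpace X] (B C₀ : Set X) : Prop :=
  ∃ δ : ℝ, 0 < δ ∧ ∀ x ∈ B, ∀ y ∈ C₀, δ ≤ dist x y

/-- The Borel measures on the complement of `C₀` that are finite on all Borel sets bounded away from
`C₀`. A measure on the complement of `C₀` is encoded as a measure on the whole space that gives no
mass to `C₀`. -/
def IsMMeasure {X : Type*} [PseudoMetricSpace X] [MeasurableSpace X] (C₀ : Set X)
    (μ : Measure X) : Prop :=
  μ C₀ = 0 ∧ ∀ B, MeasurableSet B → BoundedAway B C₀ → μ B < ∞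

/-- Convergence of integrals of all bounded continuous functions whose support is bounded away from
`C₀`. -/
def MTendsto {X ι : Type*} [PseudoMetricSpace X] [MeasurableSpace X] (C₀ : Set X)
    (ν : ι → Measure X) (l : Filter ι) (μ : Measure X) : Prop :=
  ∀ f : X →ᵇ ℝ, BoundedAway (Function.support f) C₀ →
    Tendsto (fun n => ∫ x, f x ∂(ν n)) l (𝓝 (∫ x, f x ∂μ))

/-- Regular variation at infinity with real index `β`. -/
def IsRV (f : ℝ≥0 → ℝ≥0) (β : ℝ) : Prop :=
  ∀ x : ℝ≥0, 0 < x → Tendsto (fun t => f (t * x) / f t) atTop (𝓝 (x ^ β))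

/-- Regular variation at infinity with index `∞` (rapid variation): `f (t x) / f t` tends to `x ^ ∞`,
which is `∞` for `x > 1` and `0` for `x < 1`. -/
def IsRVTop (f : ℝ≥0 → ℝ≥0) : Prop :=
  (∀ x : ℝ≥0, 1 < x → Tendsto (fun t => f (t * x) / f t) atTop atTop) ∧
    ∀ x : ℝ≥0, 0 < x → x < 1 → Tendsto (fun t => f (t * x) / f t) atTop (𝓝 0)

/-- The random vector `V` is multivariate regularly varying on the orthant without `C₀`, with index
`α ≥ 0`, scaling function `b`, regularly varying with index `1 / α` (`∞` if `α = 0`), and non-null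
limit measure `μ`. -/
def MRV {Ω : Type*} [MeasurableSpace Ω] (P : Measure Ω) {d : ℕ} (V : Ω → Fin d → ℝ≥0)
    (α : ℝ) (b : ℝ≥0 → ℝ≥0) (μ : Measure (Fin d → ℝ≥0)) (C₀ : Set (Fin d → ℝ≥0)) : Prop :=
  0 ≤ α ∧ (0 < α → IsRV b (1 / α)) ∧ (α = 0 → IsRVTop b) ∧
    IsMMeasure C₀ μ ∧ μ ≠ 0 ∧
    MTendsto C₀ (fun t : ℝ≥0 => t • P.map (fun ω => (b t)⁻¹ • V ω)) atTop μ

/-- The generalized inverse of a distribution function. -/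
def quantile (F : ℝ → ℝ) (s : ℝ) : ℝ :=
  sInf {x : ℝ | s ≤ F x}

/-- The canonical scaling function: the `(1 - 1 / t)`-quantile of the `i`-th largest coordinate
of `V`. It is nonnegative for `t > 1`. -/
def canonicalScaling {Ω : Type*} [MeasurableSpace Ω] (P : Measure Ω) {d : ℕ}
    (V : Ω → Fin d → ℝ≥0) (i : Fin d) (t : ℝ≥0) : ℝ≥0 :=
  (quantile (fun x => P.real {ω | ((orderStat (V ω) i : ℝ≥0) : ℝ) ≤ x}) (1 - 1 / (t : ℝ))).toNNReal

/-- The supremum of the ratios of the `k`-th largest coordinate of `A z` and the `i`-th largest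
coordinate of `z`, over all `z` for which the latter is positive. -/
def tau {q d : ℕ} (k : Fin q) (i : Fin d) (A : Matrix (Fin q) (Fin d) ℝ≥0) : ℝ≥0∞ :=
  ⨆ z ∈ subcone i, ((orderStat (A *ᵥ z) k : ℝ≥0) : ℝ≥0∞) / ((orderStat z i : ℝ≥0) : ℝ≥0∞)

/-- The largest index `j` with `tau k j A < ∞`. -/
def maxIndex {q d : ℕ} [NeZero d] (k : Fin q) (A : Matrix (Fin q) (Fin d) ℝ≥0) : Fin d :=
  sSup {j | tau k j A < ∞}

/-- The set of outcomes for which the matrix has `maxIndex` equal to `i`. -/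
def indexEvent {Ω : Type*} {q d : ℕ} [NeZero d] (A : Ω → Matrix (Fin q) (Fin d) ℝ≥0)
    (k : Fin q) (i : Fin d) : Set Ω :=
  {ω | maxIndex k (A ω) = i}

/-- The preimage of `C` under the linear map given by `A`. -/
def preimg {q d : ℕ} (A : Matrix (Fin q) (Fin d) ℝ≥0) (C : Set (Fin q → ℝ≥0)) :
    Set (Fin d → ℝ≥0) :=
  {z | A *ᵥ z ∈ C}

/-- The expectation of `μ (A⁻¹ C)` over the event that the index of `A` is `i`. -/
def limitMass {Ω : Type*} [MeasurableSpace Ω] (P : Measure Ω) {q d : ℕ} [NeZero d]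
    (A : Ω → Matrix (Fin q) (Fin d) ℝ≥0) (k : Fin q) (i : Fin d)
    (μ : Measure (Fin d → ℝ≥0)) (C : Set (Fin q → ℝ≥0)) : ℝ≥0∞ :=
  ∫⁻ ω in indexEvent A k i, μ (preimg (A ω) C) ∂P

/-- The smallest index whose event has positive probability. -/
def iStar {Ω : Type*} [MeasurableSpace Ω] (P : Measure Ω) {q d : ℕ} [NeZero d]
    (A : Ω → Matrix (Fin q) (Fin d) ℝ≥0) (k : Fin q) : Fin d :=
  sInf {i | 0 < P (indexEvent A k i)}

/-- The smallest index `i ≥ iStar` for which `limitMass` is positive, and the last index if there is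
none (the infimum of the empty subset of `Fin d` is its largest element). -/
def iotaBar {Ω : Type*} [MeasurableSpace Ω] (P : Measure Ω) {q d : ℕ} [NeZero d]
    (A : Ω → Matrix (Fin q) (Fin d) ℝ≥0) (k : Fin q)
    (μ : Fin d → Measure (Fin d → ℝ≥0)) (C : Set (Fin q → ℝ≥0)) : Fin d :=
  sInf {i | iStar P A k ≤ i ∧ 0 < limitMass P A k i (μ i) C}

end HiddenRV

end

open HiddenRV

/-! Split the event `A Z ∈ t C` according to the index `i` of the matrix. On `indexEvent A k i` the
constant `tau k i A` is finite, and the bound `(A z)^(k) ≤ tau * z^(i)` (`orderStat_mulVec_le`)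
keeps the preimage of `C` away from `coordPlanes i`. For a frozen matrix, regular variation then
gives `P (Z ∈ t A⁻¹ C) / P (Z^(i) > t) → μ_i (A⁻¹ C)` (`MRV.tendsto_measureReal_div_tail`). A Potter
bound dominates this ratio by `K (1 + tau ^ p)` with `p > α_i` (`MRV.exists_measure_le_rpow`), which
the moment condition makes integrable. Independence and dominated convergence therefore give the
asymptotics on each event (`limitMass_lt_top_and_tendsto`).

Divide by the tail at `iotaBar` and sum over the finitely many indices. Smaller indices contribute
zero: the event is null or the preimage of `C` is empty. Larger ones vanish, because the ratio of
their tail to the one at `iotaBar` tends to `0` (`tendsto_tail_div_tail_of_lt`).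

Passing from the scaling `b(s)` to the scaling `t` uses `s = 1 / T(t)`, where `T` is the tail
function and `b` its quantile function: `b(s) ≤ t` eventually and `b(s) / t → 1`. All facts about
tails follow from the equivalence `b s ≤ x ↔ T x ≤ 1 / s`. -/

noncomputable section

namespace HiddenRV

/-! ### Order statistics and the distance to the coordinate planes. -/

section OrderStat

variable {d : ℕ} {S : Type*} [LinearOrder S]

/-- A permutation sorting `v` also sorts `f ∘ v`. Homogeneity, translation by a constant and
truncation of order statistics are all instances. -/
theorem orderStat_comp {S' : Type*} [LinearOrder S'] {f : S → S'} (hf : Monotone f)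
    (v : Fin d → S) (i : Fin d) : orderStat (f ∘ v) i = f (orderStat v i) := by
  have h : Monotone ((f ∘ v) ∘ Tuple.sort v) := hf.comp (Tuple.monotone_sort v)
  exact (congrFun (Tuple.comp_sort_eq_comp_iff_monotone.2 h) i.rev).symm

theorem orderStat_le_iff (v : Fin d → S) (i : Fin d) (a : S) :
    orderStat v i ≤ a ↔ (i.rev : ℕ) < (Finset.univ.filter fun j => v j ≤ a).card := by
  have h := Tuple.lt_card_le_iff_apply_le_of_monotone (f := v ∘ Tuple.sort v) (a := a)
    (Tuple.monotone_sort v) (j := i.rev)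
  have hc : (Finset.univ.filter fun j => (v ∘ Tuple.sort v) j ≤ a).card
      = (Finset.univ.filter fun j => v j ≤ a).card := by
    refine Finset.card_bij (fun j _ => Tuple.sort v j) (by simp) (by simp) ?_
    intro j hj
    exact ⟨(Tuple.sort v).symm j, by simpa using hj, by simp⟩
  rw [← hc]
  exact h.symm

theorem orderStat_mono {v w : Fin d → S} (h : v ≤ w) (i : Fin d) :
    orderStat v i ≤ orderStat w i := by
  rw [orderStat_le_iff]
  refine lt_of_lt_of_le ((orderStat_le_iff w i _).1 le_rfl) (Finset.card_le_card ?_)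
  intro j hj
  simp only [Finset.mem_filter, Finset.mem_univ, true_and] at hj ⊢
  exact (h j).trans hj

theorem orderStat_antitone (v : Fin d → S) : Antitone (orderStat v) := fun _ _ h =>
  Tuple.monotone_sort v (Fin.rev_le_rev.2 h)

theorem le_orderStat_zero [NeZero d] (v : Fin d → S) (j : Fin d) : v j ≤ orderStat v 0 := by
  have := Tuple.monotone_sort v (show (Tuple.sort v).symm j ≤ (0 : Fin d).rev by
    rw [Fin.le_def, Fin.val_rev]; simp; omega)
  simpa [orderStat] using this

theorem orderStat_smul (c : ℝ≥0) (v : Fin d → ℝ≥0) (i : Fin d) :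
    orderStat (c • v) i = c * orderStat v i :=
  orderStat_comp (f := fun x => c * x) (fun _ _ h => mul_le_mul_right h c) v i

theorem orderStat_add_const (v : Fin d → ℝ≥0) (ε : ℝ≥0) (i : Fin d) :
    orderStat (fun j => v j + ε) i = orderStat v i + ε :=
  orderStat_comp (f := fun x => x + ε) (fun _ _ h => add_le_add_left h ε) v i

theorem orderStat_le_add_nndist (v w : Fin d → ℝ≥0) (i : Fin d) :
    orderStat v i ≤ orderStat w i + nndist v w := by
  rw [← orderStat_add_const]
  refine orderStat_mono (fun j => ?_) i
  have h1 : dist (v j) (w j) ≤ nndist v w := by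
    rw [coe_nndist]; exact dist_le_pi_dist v w j
  rw [NNReal.dist_eq, abs_le] at h1
  rw [← NNReal.coe_le_coe]
  push_cast
  simp only [coe_nndist] at h1
  linarith

theorem lipschitzWith_orderStat (i : Fin d) :
    LipschitzWith 1 (fun v : Fin d → ℝ≥0 => orderStat v i) := by
  refine LipschitzWith.of_dist_le_mul fun v w => ?_
  have h1 := orderStat_le_add_nndist v w i
  have h2 := orderStat_le_add_nndist w v i
  rw [nndist_comm] at h2
  rw [← NNReal.coe_le_coe] at h1 h2
  push_cast at h1 h2
  rw [NNReal.dist_eq, abs_le]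
  push_cast
  constructor <;> linarith

theorem continuous_orderStat (i : Fin d) :
    Continuous (fun v : Fin d → ℝ≥0 => orderStat v i) :=
  (lipschitzWith_orderStat i).continuous

theorem measurable_orderStat (i : Fin d) :
    Measurable (fun v : Fin d → ℝ≥0 => orderStat v i) :=
  (continuous_orderStat i).measurable

theorem orderStat_le_dist {v w : Fin d → ℝ≥0} {i : Fin d} (hw : w ∈ coordPlanes i) :
    ((orderStat v i : ℝ≥0) : ℝ) ≤ dist v w := by
  have h := orderStat_le_add_nndist v w i
  rw [show orderStat w i = 0 from hw, zero_add] at h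
  exact_mod_cast h

/-- Setting to zero every coordinate not exceeding `orderStat v i` is a monotone operation, so it
also kills the order statistic itself. With `orderStat_le_dist`, the distance to `coordPlanes i` is
exactly `orderStat v i`. -/
theorem exists_mem_coordPlanes_dist_le (v : Fin d → ℝ≥0) (i : Fin d) :
    ∃ w ∈ coordPlanes i, dist v w ≤ (orderStat v i : ℝ≥0) := by
  set f : ℝ≥0 → ℝ≥0 := fun x => if x ≤ orderStat v i then 0 else x with hfdef
  have hf : Monotone f := by
    intro x y h
    simp only [hfdef]
    split_ifs with h1 h2
    · exact le_rfl
    · exact zero_le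
    · exact absurd (h.trans ‹_›) h1
    · exact h
  refine ⟨f ∘ v, ?_, ?_⟩
  · change orderStat (f ∘ v) i = 0
    rw [orderStat_comp hf]
    simp [hfdef]
  · rw [dist_pi_le_iff NNReal.zero_le_coe]
    intro j
    simp only [Function.comp, hfdef]
    split_ifs with h1
    · simpa [NNReal.dist_eq] using h1
    · simp

theorem boundedAway_coordPlanes_iff {B : Set (Fin d → ℝ≥0)} {i : Fin d} :
    BoundedAway B (coordPlanes i) ↔ ∃ δ : ℝ≥0, 0 < δ ∧ B ⊆ {v | δ ≤ orderStat v i} := by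
  constructor
  · rintro ⟨δ, hδ, h⟩
    refine ⟨⟨δ, hδ.le⟩, hδ, fun v hv => ?_⟩
    obtain ⟨w, hw, hvw⟩ := exists_mem_coordPlanes_dist_le v i
    exact (h v hv w hw).trans hvw
  · rintro ⟨δ, hδ, h⟩
    exact ⟨δ, hδ, fun v hv w hw =>
      (NNReal.coe_le_coe.2 (h hv)).trans (orderStat_le_dist hw)⟩

end OrderStat

/-! ### The growth constants `tau` and the index of a matrix. -/

section Tau

variable {q d : ℕ}

theorem mulVec_mono (A : Matrix (Fin q) (Fin d) ℝ≥0) {z w : Fin d → ℝ≥0} (h : z ≤ w) :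
    A *ᵥ z ≤ A *ᵥ w := fun r =>
  Finset.sum_le_sum fun j _ => mul_le_mul_right (h j) (A r j)

theorem continuous_mulVec_uncurry :
    Continuous fun p : (Fin q → Fin d → ℝ≥0) × (Fin d → ℝ≥0) =>
      (Matrix.of p.1 : Matrix (Fin q) (Fin d) ℝ≥0) *ᵥ p.2 := by
  refine continuous_pi fun r => ?_
  simp only [Matrix.mulVec, dotProduct, Matrix.of_apply]
  fun_prop

theorem measurable_mulVec_uncurry :
    Measurable fun p : Matrix (Fin q) (Fin d) ℝ≥0 × (Fin d → ℝ≥0) => p.1 *ᵥ p.2 :=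
  (continuous_mulVec_uncurry (q := q) (d := d)).measurable

theorem orderStat_mulVec_le_of_mem_subcone (k : Fin q) (i : Fin d)
    (A : Matrix (Fin q) (Fin d) ℝ≥0) {z : Fin d → ℝ≥0} (hz : z ∈ subcone i) :
    ((orderStat (A *ᵥ z) k : ℝ≥0) : ℝ≥0∞) ≤ tau k i A * (orderStat z i : ℝ≥0) := by
  have hz' : orderStat z i ≠ 0 := hz
  rw [← ENNReal.div_le_iff (by simpa using hz') (by simp)]
  exact le_iSup₂_of_le z hz le_rfl

/-- The supremum only sees vectors in the subcone. Adding `ε` to every coordinate moves any `z`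
there; monotonicity of `A` and `ε → 0` then cover the coordinate planes too. -/
theorem orderStat_mulVec_le (k : Fin q) (i : Fin d) {A : Matrix (Fin q) (Fin d) ℝ≥0}
    (hA : tau k i A < ∞) (z : Fin d → ℝ≥0) :
    orderStat (A *ᵥ z) k ≤ (tau k i A).toNNReal * orderStat z i := by
  have key : ∀ ε : ℝ≥0, 0 < ε →
      orderStat (A *ᵥ z) k ≤ (tau k i A).toNNReal * (orderStat z i + ε) := by
    intro ε hε
    have hmem : (fun j => z j + ε) ∈ subcone i := by
      change ¬ orderStat (fun j => z j + ε) i = 0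
      rw [orderStat_add_const]
      positivity
    have h := orderStat_mulVec_le_of_mem_subcone k i A hmem
    rw [orderStat_add_const] at h
    have h2 : orderStat (A *ᵥ z) k ≤ orderStat (A *ᵥ fun j => z j + ε) k :=
      orderStat_mono (mulVec_mono A fun j => le_self_add) k
    refine h2.trans ?_
    rw [← ENNReal.coe_le_coe]
    refine h.trans_eq ?_
    rw [ENNReal.coe_mul, ENNReal.coe_toNNReal hA.ne]
  have hlim : Tendsto (fun ε : ℝ≥0 => (tau k i A).toNNReal * (orderStat z i + ε)) (𝓝[>] 0)
      (𝓝 ((tau k i A).toNNReal * (orderStat z i + 0))) := by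
    refine Tendsto.mono_left (Continuous.tendsto ?_ 0) nhdsWithin_le_nhds
    fun_prop
  rw [add_zero] at hlim
  refine ge_of_tendsto hlim ?_
  filter_upwards [self_mem_nhdsWithin] with ε hε using key ε hε

theorem orderStat_le_of_forall_le {v : Fin d → ℝ≥0} {a : ℝ≥0} (h : ∀ j, v j ≤ a) (i : Fin d) :
    orderStat v i ≤ a := h _

theorem tau_zero_lt_top [NeZero d] (k : Fin q) (A : Matrix (Fin q) (Fin d) ℝ≥0) :
    tau k 0 A < ∞ := by
  refine lt_of_le_of_lt (b := ((∑ r, ∑ j, A r j : ℝ≥0) : ℝ≥0∞)) ?_ ENNReal.coe_lt_top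
  refine iSup₂_le fun z _ => ENNReal.div_le_of_le_mul ?_
  rw [← ENNReal.coe_mul, ENNReal.coe_le_coe]
  refine orderStat_le_of_forall_le (fun r => ?_) k
  calc (A *ᵥ z) r = ∑ j, A r j * z j := rfl
    _ ≤ ∑ j, A r j * orderStat z 0 :=
        Finset.sum_le_sum fun j _ => mul_le_mul_right (le_orderStat_zero z j) _
    _ = (∑ j, A r j) * orderStat z 0 := (Finset.sum_mul _ _ _).symm
    _ ≤ (∑ r, ∑ j, A r j) * orderStat z 0 := mul_le_mul_left
        (Finset.single_le_sum (f := fun r => ∑ j, A r j) (fun _ _ => zero_le)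
          (Finset.mem_univ r)) _

theorem tau_maxIndex_lt_top [NeZero d] (k : Fin q) (A : Matrix (Fin q) (Fin d) ℝ≥0) :
    tau k (maxIndex k A) A < ∞ :=
  Set.Nonempty.csSup_mem (s := {j | tau k j A < ∞}) ⟨0, tau_zero_lt_top k A⟩ (Set.toFinite _)

theorem maxIndex_eq_iff [NeZero d] (k : Fin q) (A : Matrix (Fin q) (Fin d) ℝ≥0) (i : Fin d) :
    maxIndex k A = i ↔ tau k i A < ∞ ∧ ∀ j, i < j → tau k j A = ∞ := by
  constructor
  · rintro rfl
    refine ⟨tau_maxIndex_lt_top k A, fun j hj => ?_⟩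
    by_contra h
    exact hj.not_ge (le_csSup (Set.toFinite _).bddAbove (lt_top_iff_ne_top.2 h))
  · rintro ⟨h1, h2⟩
    refine le_antisymm ?_ (le_csSup (Set.toFinite _).bddAbove h1)
    by_contra! h
    exact (tau_maxIndex_lt_top k A).ne (h2 _ h)

/-- The supremum is over an uncountable family, but each ratio is continuous in the matrix, so the
supremum is lower semicontinuous. -/
theorem measurable_tau (k : Fin q) (i : Fin d) :
    Measurable (tau k i : Matrix (Fin q) (Fin d) ℝ≥0 → ℝ≥0∞) := by
  have h : LowerSemicontinuous fun a : Fin q → Fin d → ℝ≥0 =>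
      tau k i (Matrix.of a : Matrix (Fin q) (Fin d) ℝ≥0) := by
    refine lowerSemicontinuous_biSup fun z hz => Continuous.lowerSemicontinuous ?_
    have hz' : orderStat z i ≠ 0 := hz
    refine ENNReal.continuous_div_const _ (by simpa using hz') |>.comp ?_
    have h1 : Continuous fun a : Fin q → Fin d → ℝ≥0 =>
        (Matrix.of a : Matrix (Fin q) (Fin d) ℝ≥0) *ᵥ z :=
      continuous_mulVec_uncurry.comp (continuous_id.prodMk continuous_const)
    exact ENNReal.continuous_coe.comp ((continuous_orderStat k).comp h1)
  exact h.measurable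

theorem measurableSet_maxIndex_eq [NeZero d] (k : Fin q) (i : Fin d) :
    MeasurableSet {A : Matrix (Fin q) (Fin d) ℝ≥0 | maxIndex k A = i} := by
  simp only [maxIndex_eq_iff]
  refine (measurableSet_lt (measurable_tau k i) measurable_const).inter ?_
  rw [show (fun A : Matrix (Fin q) (Fin d) ℝ≥0 => ∀ j, i < j → tau k j A = ∞)
    = {A : Matrix (Fin q) (Fin d) ℝ≥0 | ∀ j, i < j → tau k j A = ∞} from rfl]
  simp only [Set.ofPred_forall]
  exact MeasurableSet.iInter fun j => MeasurableSet.iInter fun _ =>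
    measurable_tau k j (measurableSet_singleton ∞)

theorem preimg_subset {k : Fin q} {i : Fin d} {A : Matrix (Fin q) (Fin d) ℝ≥0}
    (hA : tau k i A < ∞) {C : Set (Fin q → ℝ≥0)} {δ : ℝ≥0}
    (hC : C ⊆ {v | δ ≤ orderStat v k}) :
    preimg A C ⊆ {z | δ ≤ (tau k i A).toNNReal * orderStat z i} := fun z hz =>
  (hC hz).trans (orderStat_mulVec_le k i hA z)

theorem measurableSet_preimg (A : Matrix (Fin q) (Fin d) ℝ≥0) {C : Set (Fin q → ℝ≥0)}
    (hC : MeasurableSet C) : MeasurableSet (preimg A C) :=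
  (measurable_mulVec_uncurry.comp (measurable_const.prodMk measurable_id)) hC

theorem mulVec_mem_smul_iff (A : Matrix (Fin q) (Fin d) ℝ≥0) (C : Set (Fin q → ℝ≥0))
    {t : ℝ≥0} (ht : t ≠ 0) (z : Fin d → ℝ≥0) :
    A *ᵥ z ∈ t • C ↔ t⁻¹ • z ∈ preimg A C := by
  rw [Set.mem_smul_set_iff_inv_smul_mem₀ ht, preimg, Set.mem_ofPred_eq, Matrix.mulVec_smul]

end Tau

/-! ### Tail functions, their quantile functions and regular variation in one variable. -/

section TailQuantile

/-- `b` is the quantile function belonging to the tail function `T`. -/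
structure IsTailQuantile (T b : ℝ≥0 → ℝ≥0) : Prop where
  antitone : Antitone T
  le_one : ∀ x, T x ≤ 1
  tendsto_zero : Tendsto T atTop (𝓝 0)
  le_iff : ∀ s, 1 < s → ∀ x, b s ≤ x ↔ T x ≤ s⁻¹

namespace IsTailQuantile

variable {T b : ℝ≥0 → ℝ≥0}

theorem tail_le (h : IsTailQuantile T b) {s : ℝ≥0} (hs : 1 < s) : T (b s) ≤ s⁻¹ :=
  (h.le_iff s hs _).1 le_rfl

theorem tail_pos_of_unbounded (h : IsTailQuantile T b)
    (hb : ∀ M, ∃ s, 1 < s ∧ M < b s) (t : ℝ≥0) : 0 < T t := by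
  by_contra! h0
  obtain ⟨s, hs, hM⟩ := hb t
  exact hM.not_ge ((h.le_iff s hs t).2 (h0.trans zero_le))

/-- Along `s₁ * 2 ^ n` the values of `b` grow at least like `c ^ n`. -/
theorem unbounded_of_ratio {c : ℝ≥0} (hc : 1 < c)
    (hr : ∀ᶠ t in atTop, c < b (t * 2) / b t) (M : ℝ≥0) : ∃ s, 1 < s ∧ M < b s := by
  obtain ⟨s₀, hs₀⟩ := eventually_atTop.1 hr
  set s₁ := max s₀ 2 with hs₁
  have hge : ∀ n : ℕ, s₁ ≤ s₁ * 2 ^ n := fun n => le_mul_of_one_le_right' (one_le_pow₀ one_le_two)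
  -- Division by zero gives zero, which cannot exceed `c`.
  have hpos : 0 < b s₁ := by
    rcases eq_or_ne (b s₁) 0 with h0 | h0
    · have := hs₀ s₁ (le_max_left _ _)
      rw [h0, div_zero] at this
      exact absurd this not_lt_zero
    · exact pos_iff_ne_zero.2 h0
  have hstep : ∀ n : ℕ, (c : ℝ) * b (s₁ * 2 ^ n) ≤ b (s₁ * 2 ^ (n + 1)) := by
    intro n
    have h1 := hs₀ (s₁ * 2 ^ n) ((le_max_left _ _).trans (hge n))
    rw [mul_assoc, ← pow_succ] at h1
    rcases eq_or_ne (b (s₁ * 2 ^ n)) 0 with h0 | h0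
    · simp [h0]
    · exact_mod_cast ((lt_div_iff₀ (pos_iff_ne_zero.2 h0)).1 h1).le
  have hlim := tendsto_atTop_of_geom_le (v := fun n : ℕ => (b (s₁ * 2 ^ n) : ℝ))
    (by simpa using hpos) (by exact_mod_cast hc) hstep
  obtain ⟨n, hn⟩ := (hlim.eventually_gt_atTop (M : ℝ)).exists
  refine ⟨s₁ * 2 ^ n, lt_of_lt_of_le ?_ (hge n), by exact_mod_cast hn⟩
  exact one_lt_two.trans_le (le_max_right _ _)

theorem unbounded_of_isRV {β : ℝ} (hβ : 0 < β) (hb : IsRV b β) (M : ℝ≥0) :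
    ∃ s, 1 < s ∧ M < b s := by
  have h1 : (1 : ℝ≥0) < 2 ^ β := NNReal.one_lt_rpow one_lt_two hβ
  obtain ⟨c, hc, hc'⟩ := exists_between h1
  exact unbounded_of_ratio hc ((hb 2 two_pos).eventually (lt_mem_nhds hc')) M

theorem unbounded_of_isRVTop (hb : IsRVTop b) (M : ℝ≥0) : ∃ s, 1 < s ∧ M < b s :=
  unbounded_of_ratio one_lt_two ((hb.1 2 one_lt_two).eventually_gt_atTop 2) M

theorem tendsto_scale (h : IsTailQuantile T b) (hpos : ∀ t, 0 < T t) : Tendsto b atTop atTop := by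
  refine tendsto_atTop.2 fun M => ?_
  filter_upwards [eventually_gt_atTop 1, eventually_gt_atTop (T M)⁻¹] with s hs hs'
  by_contra! hlt
  have := (h.le_iff s hs M).1 hlt.le
  exact this.not_gt (inv_lt_of_inv_lt₀ (hpos M) hs')

theorem tendsto_inv_tail (h : IsTailQuantile T b) (hpos : ∀ t, 0 < T t) :
    Tendsto (fun t => (T t)⁻¹) atTop atTop := by
  refine tendsto_inv_nhdsGT_zero.comp ?_
  rw [tendsto_nhdsWithin_iff]
  exact ⟨h.tendsto_zero, Eventually.of_forall hpos⟩

theorem scale_inv_tail_le (h : IsTailQuantile T b) (hpos : ∀ t, 0 < T t) :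
    ∀ᶠ t in atTop, b (T t)⁻¹ ≤ t := by
  filter_upwards [(h.tendsto_inv_tail hpos).eventually_gt_atTop 1] with t ht
  rw [h.le_iff _ ht, inv_inv]

variable {α : ℝ}

/-- Since `T` may jump, `b (1 / T t)` can fall below `t`. But `b (c / T t) > t` for every `c > 1`,
and regular variation makes `b (c / T t)` comparable to `c ^ (1 / α) * b (1 / T t)`; letting `c`
decrease to `1` bounds the loss. -/
theorem tendsto_scale_inv_tail_div (h : IsTailQuantile T b) (hpos : ∀ t, 0 < T t)
    (hα : 0 < α) (hb : IsRV b (1 / α)) :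
    Tendsto (fun t => b (T t)⁻¹ / t) atTop (𝓝 1) := by
  have hs := h.tendsto_inv_tail hpos
  refine tendsto_order.2 ⟨fun l hl => ?_, fun u hu => ?_⟩
  · obtain ⟨l₁, hl₁, hl₁'⟩ := exists_between hl
    obtain ⟨l', hl', hl1⟩ := exists_between hl₁'
    have hl₁0 : 0 < l₁ := pos_of_gt hl₁
    have hl'0 : 0 < l' := pos_of_gt hl'
    -- The factor `c = l'⁻¹ ^ α` is chosen so that `c ^ (1 / α) = l'⁻¹`.
    have hc : 1 < l'⁻¹ ^ α := NNReal.one_lt_rpow ((one_lt_inv₀ hl'0).2 hl1) hα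
    have hlim := (hb (l'⁻¹ ^ α) (zero_lt_one.trans hc)).comp hs
    rw [← NNReal.rpow_mul, mul_one_div_cancel hα.ne', NNReal.rpow_one] at hlim
    filter_upwards [hlim.eventually (gt_mem_nhds (inv_strictAnti₀ hl₁0 hl')),
      hs.eventually_gt_atTop 1, eventually_gt_atTop 0,
      hs.eventually ((h.tendsto_scale hpos).eventually_gt_atTop 0)] with t h1 h2 ht h3
    simp only [Function.comp] at h1
    rw [div_lt_iff₀ h3] at h1
    have h4 : t < b ((T t)⁻¹ * l'⁻¹ ^ α) := by
      by_contra! hlt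
      rw [h.le_iff _ (h2.trans (lt_mul_of_one_lt_right (zero_lt_one.trans h2) hc)), mul_inv,
        inv_inv] at hlt
      exact (mul_lt_of_lt_one_right (hpos t) (inv_lt_one_of_one_lt₀ hc)).not_ge hlt
    refine hl₁.trans ?_
    rw [lt_div_iff₀ ht]
    have h5 := h4.trans h1
    rwa [inv_mul_eq_div, lt_div_iff₀ hl₁0, mul_comm] at h5
  · filter_upwards [h.scale_inv_tail_le hpos] with t h1
    exact (div_le_one_of_le₀ h1 zero_le).trans_lt hu

theorem tendsto_scale_mul_div (h : IsTailQuantile T b) (hpos : ∀ t, 0 < T t)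
    (hα : 0 < α) (hb : IsRV b (1 / α)) {x : ℝ≥0} (hx : 0 < x) :
    Tendsto (fun t => b ((T t)⁻¹ * x) / t) atTop (𝓝 (x ^ (1 / α))) := by
  have hs := h.tendsto_inv_tail hpos
  have h1 := ((hb x hx).comp hs).mul (h.tendsto_scale_inv_tail_div hpos hα hb)
  rw [mul_one] at h1
  refine h1.congr' ?_
  filter_upwards [hs.eventually ((h.tendsto_scale hpos).eventually_gt_atTop 0)] with t h3
  simp only [Function.comp]
  rw [div_mul_div_cancel₀ h3.ne']

/-- Inversion: comparing `T (y t)` with `u * T t` is the same as comparing `b (u⁻¹ / T t)` with `y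
t`, and `b (x / T t) / t → x ^ (1 / α)`. -/
theorem tendsto_tail_div (h : IsTailQuantile T b) (hpos : ∀ t, 0 < T t)
    (hα : 0 < α) (hb : IsRV b (1 / α)) {y : ℝ≥0} (hy : 0 < y) :
    Tendsto (fun t => T (y * t) / T t) atTop (𝓝 (y ^ (-α))) := by
  have hs := h.tendsto_inv_tail hpos
  have hinv : (y ^ (-α))⁻¹ ^ (1 / α) = y := by
    rw [NNReal.rpow_neg, inv_inv, ← NNReal.rpow_mul, mul_one_div_cancel hα.ne', NNReal.rpow_one]
  have hy' : 0 < y ^ (-α) := NNReal.rpow_pos hy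
  refine tendsto_order.2 ⟨fun l hl => ?_, fun u hu => ?_⟩
  · rcases eq_or_ne l 0 with h0 | h0
    · exact Eventually.of_forall fun t => h0 ▸ div_pos (hpos _) (hpos _)
    · have hl0 : 0 < l := pos_iff_ne_zero.2 h0
      have hx : y < l⁻¹ ^ (1 / α) := by
        conv_lhs => rw [← hinv]
        exact NNReal.rpow_lt_rpow (inv_strictAnti₀ hl0 hl) (by positivity)
      filter_upwards [(h.tendsto_scale_mul_div hpos hα hb (inv_pos.2 hl0)).eventually
        (lt_mem_nhds hx), (hs.atTop_mul_const (inv_pos.2 hl0)).eventually_gt_atTop 1,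
        eventually_gt_atTop 0] with t h1 h2 ht
      rw [lt_div_iff₀ ht] at h1
      have h3 := mt (h.le_iff _ h2 (y * t)).2 h1.not_ge
      rw [mul_inv, inv_inv, inv_inv, not_le] at h3
      rwa [lt_div_iff₀ (hpos t), mul_comm]
  · obtain ⟨u', hu', huu⟩ := exists_between hu
    have hu0 : 0 < u' := hy'.trans hu'
    have hx : u'⁻¹ ^ (1 / α) < y := by
      conv_rhs => rw [← hinv]
      exact NNReal.rpow_lt_rpow (inv_strictAnti₀ hy' hu') (by positivity)
    filter_upwards [(h.tendsto_scale_mul_div hpos hα hb (inv_pos.2 hu0)).eventually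
      (gt_mem_nhds hx), (hs.atTop_mul_const (inv_pos.2 hu0)).eventually_gt_atTop 1,
      eventually_gt_atTop 0] with t h1 h2 ht
    rw [div_lt_iff₀ ht] at h1
    have h3 := (h.le_iff _ h2 (y * t)).1 h1.le
    rw [mul_inv, inv_inv, inv_inv] at h3
    refine lt_of_le_of_lt ?_ huu
    rwa [div_le_iff₀ (hpos t), mul_comm u']

theorem eventually_mul_tail_lt (h : IsTailQuantile T b) (hpos : ∀ t, 0 < T t)
    (hα : 0 < α) (hb : IsRV b (1 / α)) {y : ℝ≥0} (hy : 0 < y) {u : ℝ≥0} (hu : y ^ (-α) < u) :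
    ∀ᶠ s in atTop, s * T (y * b s) < u := by
  filter_upwards [((h.tendsto_tail_div hpos hα hb hy).comp (h.tendsto_scale hpos)).eventually
    (gt_mem_nhds hu), eventually_gt_atTop 1] with s h1 hs
  refine lt_of_le_of_lt ?_ h1
  simp only [Function.comp]
  rw [div_eq_mul_inv, mul_comm]
  refine mul_le_mul_right ?_ _
  have := h.tail_le hs
  rwa [le_inv_comm₀ (zero_lt_one.trans hs) (hpos _)]

/-- Each halving of a large argument costs a factor of at most `2 ^ p`. Once the argument drops
below `t₀`, the trivial bound `T ≤ 1` takes over, and `K = 1 / T t₀` pays for it; hence no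
restriction on `n`. -/
theorem potter (h : IsTailQuantile T b) (hpos : ∀ t, 0 < T t)
    (hα : 0 < α) (hb : IsRV b (1 / α)) {p : ℝ} (hp : α < p) :
    ∃ K t₀ : ℝ≥0, ∀ n : ℕ, ∀ t, t₀ ≤ t → T (t / 2 ^ n) ≤ K * (2 ^ p) ^ n * T t := by
  have h2 : ((2 : ℝ≥0)⁻¹) ^ (-α) < 2 ^ p := by
    rw [NNReal.inv_rpow, NNReal.rpow_neg, inv_inv]
    exact NNReal.rpow_lt_rpow_of_exponent_lt one_lt_two hp
  obtain ⟨t₀, ht₀⟩ := eventually_atTop.1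
    ((h.tendsto_tail_div hpos hα hb (inv_pos.2 two_pos)).eventually (gt_mem_nhds h2))
  have hstep : ∀ t, t₀ ≤ t → T (t / 2) ≤ 2 ^ p * T t := by
    intro t ht
    have h3 := ht₀ t ht
    rw [div_lt_iff₀ (hpos t), inv_mul_eq_div] at h3
    exact h3.le
  have hp1 : (1 : ℝ≥0) ≤ 2 ^ p := NNReal.one_le_rpow one_le_two (hα.trans hp).le
  have hK : 1 ≤ (T t₀)⁻¹ := (one_le_inv₀ (hpos t₀)).2 (h.le_one _)
  refine ⟨(T t₀)⁻¹, t₀, fun n => ?_⟩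
  induction n with
  | zero =>
    intro t _
    rw [pow_zero, pow_zero, div_one, mul_one]
    exact le_mul_of_one_le_left' hK
  | succ n ih =>
    intro t ht
    have hd : t / 2 ^ (n + 1) = t / 2 / 2 ^ n := by rw [pow_succ', div_div]
    rw [hd, pow_succ]
    rcases le_total t₀ (t / 2) with h3 | h3
    · calc T (t / 2 / 2 ^ n) ≤ (T t₀)⁻¹ * (2 ^ p) ^ n * T (t / 2) := ih _ h3
        _ ≤ (T t₀)⁻¹ * (2 ^ p) ^ n * (2 ^ p * T t) := mul_le_mul_right (hstep t ht) _
        _ = _ := by ring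
    · calc T (t / 2 / 2 ^ n) ≤ 1 := h.le_one _
        _ = (T t₀)⁻¹ * 1 * T t₀ := by rw [mul_one, inv_mul_cancel₀ (hpos t₀).ne']
        _ ≤ (T t₀)⁻¹ * (2 ^ p) ^ n * (2 ^ p * T t) := by
            gcongr
            · exact one_le_pow₀ hp1
            · exact (h.antitone h3).trans (hstep t ht)
        _ = _ := by ring

/-- With `s = 1 / T t`, the ratio is `s * T' t`, and eventually `t ≥ b s ≥ K * b' s` for any fixed
`K`. So it is at most `s * T' (K * b' s)`, whose upper limit is at most `K ^ (-α)`. -/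
theorem tendsto_tail_div_tail {T' b' : ℝ≥0 → ℝ≥0} (h : IsTailQuantile T b)
    (hpos : ∀ t, 0 < T t) (h' : IsTailQuantile T' b') (hpos' : ∀ t, 0 < T' t)
    (hα : 0 < α) (hb' : IsRV b' (1 / α)) (hbb : Tendsto (fun t => b t / b' t) atTop atTop) :
    Tendsto (fun t => T' t / T t) atTop (𝓝 0) := by
  refine tendsto_order.2 ⟨fun l hl => absurd hl not_lt_zero, fun u hu => ?_⟩
  have hs := h.tendsto_inv_tail hpos
  obtain ⟨v, hv, hvu⟩ := exists_between hu
  set K : ℝ≥0 := v ^ (-(1 / α)) with hK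
  have hKpos : 0 < K := NNReal.rpow_pos hv
  have hKu : K ^ (-α) < u := by
    rw [hK, ← NNReal.rpow_mul, neg_mul_neg, one_div_mul_cancel hα.ne', NNReal.rpow_one]
    exact hvu
  filter_upwards [hs.eventually (h'.eventually_mul_tail_lt hpos' hα hb' hKpos hKu),
    hs.eventually (hbb.eventually_ge_atTop K), h.scale_inv_tail_le hpos,
    hs.eventually ((h'.tendsto_scale hpos').eventually_gt_atTop 0)] with t h1 h2 h3 h4
  rw [div_eq_mul_inv, mul_comm]
  refine lt_of_le_of_lt (mul_le_mul_right (h'.antitone ?_) _) h1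
  exact ((le_div_iff₀ h4).1 h2).trans h3

end IsTailQuantile

end TailQuantile

/-! ### The canonical scaling is the quantile function of the tail. -/

section CanonicalScaling

/-- Right-continuity of the distribution function shows that the infimum is attained. The
assumptions on `p` and `h0` make the set nonempty and bounded below, so that `sInf` is a true
infimum. -/
theorem quantile_le_iff (ρ : Measure ℝ) [IsProbabilityMeasure ρ] (h0 : ∀ x < 0, cdf ρ x = 0)
    {p : ℝ} (hp0 : 0 < p) (hp1 : p < 1) (x : ℝ) :
    quantile (cdf ρ) p ≤ x ↔ p ≤ cdf ρ x := by
  have hbdd : BddBelow {x : ℝ | p ≤ cdf ρ x} := by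
    refine ⟨0, fun y hy => ?_⟩
    by_contra! h
    have hy' : p ≤ cdf ρ y := hy
    rw [h0 y h] at hy'
    exact hy'.not_gt hp0
  have hne : {x : ℝ | p ≤ cdf ρ x}.Nonempty := by
    obtain ⟨y, hy⟩ := ((tendsto_cdf_atTop ρ).eventually (lt_mem_nhds hp1)).exists
    exact ⟨y, hy.le⟩
  refine ⟨fun h => ?_, fun h => csInf_le hbdd h⟩
  refine le_trans ?_ (monotone_cdf ρ h)
  have hcont : Tendsto (cdf ρ) (𝓝[>] quantile (cdf ρ) p) (𝓝 (cdf ρ (quantile (cdf ρ) p))) :=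
    ((cdf ρ).right_continuous _).mono_left (nhdsWithin_mono _ Set.Ioi_subset_Ici_self)
  refine ge_of_tendsto hcont ?_
  filter_upwards [self_mem_nhdsWithin] with y hy
  obtain ⟨z, hz, hzy⟩ := exists_lt_of_csInf_lt hne hy
  exact le_trans hz (monotone_cdf ρ hzy.le)

variable {Ω : Type*} [MeasurableSpace Ω] {d : ℕ}

/-- The tail function of the `i`-th largest coordinate of `V`. -/
def tail (P : Measure Ω) (V : Ω → Fin d → ℝ≥0) (i : Fin d) (x : ℝ≥0) : ℝ≥0 :=
  (P {ω | x < orderStat (V ω) i}).toNNReal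

theorem coe_tail (P : Measure Ω) (V : Ω → Fin d → ℝ≥0) (i : Fin d) (x : ℝ≥0) :
    (tail P V i x : ℝ) = P.real {ω | x < orderStat (V ω) i} := rfl

variable (P : Measure Ω) [IsProbabilityMeasure P] {V : Ω → Fin d → ℝ≥0}

theorem ennreal_coe_tail (V : Ω → Fin d → ℝ≥0) (i : Fin d) (x : ℝ≥0) :
    (tail P V i x : ℝ≥0∞) = P {ω | x < orderStat (V ω) i} :=
  ENNReal.coe_toNNReal (measure_ne_top _ _)

theorem tail_mono_index (V : Ω → Fin d → ℝ≥0) {i j : Fin d} (h : i ≤ j) (x : ℝ≥0) :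
    tail P V j x ≤ tail P V i x := by
  rw [← ENNReal.coe_le_coe, ennreal_coe_tail, ennreal_coe_tail]
  refine measure_mono fun ω (hω : x < _) => ?_
  exact hω.trans_le (orderStat_antitone (V ω) h)

theorem isTailQuantile_canonicalScaling (hV : Measurable V) (i : Fin d) :
    IsTailQuantile (tail P V i) (canonicalScaling P V i) := by
  set X : Ω → ℝ := fun ω => (orderStat (V ω) i : ℝ≥0) with hX
  have hXm : Measurable X := measurable_coe_nnreal_real.comp ((measurable_orderStat i).comp hV)
  have : IsProbabilityMeasure (P.map X) := Measure.isProbabilityMeasure_map hXm.aemeasurable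
  have hF : ∀ x, cdf (P.map X) x = P.real {ω | X ω ≤ x} := by
    intro x
    rw [cdf_eq_real, map_measureReal_apply hXm measurableSet_Iic]
    rfl
  have hF' : (fun x => P.real {ω | ((orderStat (V ω) i : ℝ≥0) : ℝ) ≤ x}) = cdf (P.map X) :=
    funext fun x => (hF x).symm
  have hT : ∀ x : ℝ≥0, (tail P V i x : ℝ) = 1 - cdf (P.map X) x := by
    intro x
    have h1 := probReal_compl_eq_one_sub (μ := P) (hXm (measurableSet_Iic (a := (x : ℝ))))
    rw [hF, coe_tail]
    refine Eq.trans (congrArg P.real ?_) h1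
    ext ω
    simp [hX]
  have h0 : ∀ x < 0, cdf (P.map X) x = 0 := by
    intro x hx
    rw [hF]
    have : {ω | X ω ≤ x} = ∅ := by
      ext ω
      simp only [Set.mem_ofPred_eq, Set.mem_empty_iff_false, iff_false, not_le]
      exact hx.trans_le (NNReal.coe_nonneg _)
    rw [this, measureReal_empty]
  refine ⟨fun x y h => ?_, fun x => ?_, ?_, fun s hs x => ?_⟩
  · rw [← NNReal.coe_le_coe, hT, hT]
    have := monotone_cdf (P.map X) (NNReal.coe_le_coe.2 h)
    linarith
  · rw [← NNReal.coe_le_coe, hT]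
    have := cdf_nonneg (P.map X) x
    push_cast
    linarith
  · rw [← NNReal.tendsto_coe]
    simp only [hT]
    have := ((tendsto_cdf_atTop (P.map X)).comp
      (NNReal.tendsto_coe_atTop.2 tendsto_id)).const_sub 1
    simpa using this
  · have hs' : (1 : ℝ) < s := by exact_mod_cast hs
    have hinv : 1 / (s : ℝ) < 1 := by
      rw [div_lt_one (by linarith)]; exact hs'
    have hinv0 : 0 < 1 / (s : ℝ) := by positivity
    rw [canonicalScaling, hF', Real.toNNReal_le_iff_le_coe,
      quantile_le_iff _ h0 (by linarith) (by linarith), ← NNReal.coe_le_coe, hT]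
    push_cast
    rw [one_div]
    constructor <;> intro h <;> linarith

end CanonicalScaling

/-! ### Portmanteau inequalities for convergence away from a closed-off set. -/

section MConvergence

variable {X ι : Type*} [PseudoMetricSpace X] {C₀ : Set X}

theorem BoundedAway.mono {B B' : Set X} (h : BoundedAway B C₀) (hB : B' ⊆ B) :
    BoundedAway B' C₀ := by
  obtain ⟨δ, hδ, h⟩ := h
  exact ⟨δ, hδ, fun x hx => h x (hB hx)⟩

theorem BoundedAway.exists_thickening {B : Set X} (h : BoundedAway B C₀) :
    ∃ δ : ℝ, 0 < δ ∧ BoundedAway (Metric.thickening δ B) C₀ := by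
  obtain ⟨δ, hδ, h⟩ := h
  refine ⟨δ / 2, half_pos hδ, δ / 2, half_pos hδ, fun x hx y hy => ?_⟩
  obtain ⟨z, hz, hxz⟩ := Metric.mem_thickening_iff.1 hx
  have := h z hz y hy
  have := dist_triangle z x y
  rw [dist_comm z x] at this
  linarith

variable [MeasurableSpace X] [OpensMeasurableSpace X]
  {ν : ι → Measure X} {l : Filter ι} {μ : Measure X}

/-- Between a set and a thickening that is bounded away from `C₀` there is a function to which
convergence of measures applies. -/
theorem MTendsto.exists_real_tendsto (h : MTendsto C₀ ν l μ) (hμ : IsMMeasure C₀ μ)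
    [∀ n, IsFiniteMeasure (ν n)] {F : Set X} {δ : ℝ} (hδ : 0 < δ)
    (hF : BoundedAway (Metric.thickening δ F) C₀) :
    ∃ (a : ι → ℝ) (a₀ : ℝ), Tendsto a l (𝓝 a₀) ∧
      (∀ n, (ν n).real F ≤ a n ∧ a n ≤ (ν n).real (Metric.thickening δ F)) ∧
      μ.real F ≤ a₀ ∧ a₀ ≤ μ.real (Metric.thickening δ F) := by
  set g : X →ᵇ ℝ≥0 := thickenedIndicator hδ F with hg
  set f : X →ᵇ ℝ := BoundedContinuousFunction.ofNormedAddCommGroup (fun x => (g x : ℝ))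
    (NNReal.continuous_coe.comp g.continuous) 1 (fun x => by
      rw [Real.norm_of_nonneg (NNReal.coe_nonneg _)]
      exact_mod_cast thickenedIndicator_le_one hδ F x) with hf
  have hsupp : Function.support f ⊆ Metric.thickening δ F := by
    intro x hx
    by_contra hx'
    exact hx (congrArg NNReal.toReal (thickenedIndicator_zero hδ F hx'))
  have hbound : ∀ ρ : Measure X, ρ (Metric.thickening δ F) < ∞ →
      ρ.real F ≤ ∫ x, f x ∂ρ ∧ ∫ x, f x ∂ρ ≤ ρ.real (Metric.thickening δ F) := by
    intro ρ hρ
    have hle : ∫⁻ x, g x ∂ρ ≤ ρ (Metric.thickening δ F) := by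
      rw [← lintegral_indicator_one Metric.isOpen_thickening.measurableSet]
      refine lintegral_mono fun x => ?_
      by_cases hx : x ∈ Metric.thickening δ F
      · have h1 : g x ≤ 1 := thickenedIndicator_le_one hδ F x
        simpa [hx] using h1
      · have h0 : g x = 0 := thickenedIndicator_zero hδ F hx
        simp [hx, h0]
    have hint : ∫ x, f x ∂ρ = (∫⁻ x, g x ∂ρ).toReal :=
      (BoundedContinuousFunction.toReal_lintegral_coe_eq_integral g ρ).symm
    rw [hint]
    refine ⟨ENNReal.toReal_mono (hle.trans_lt hρ).ne ?_, ENNReal.toReal_mono hρ.ne hle⟩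
    calc ρ F ≤ ρ {x | 1 ≤ (g x : ℝ≥0∞)} := measure_mono fun x hx => by
          change (1 : ℝ≥0∞) ≤ (g x : ℝ≥0∞)
          rw [hg, thickenedIndicator_one hδ F hx, ENNReal.coe_one]
      _ ≤ ∫⁻ x, g x ∂ρ := by
          have := mul_meas_ge_le_lintegral (μ := ρ) (f := fun x => (g x : ℝ≥0∞))
            (measurable_coe_nnreal_ennreal.comp g.continuous.measurable) 1
          simpa using this
  exact ⟨fun n => ∫ x, f x ∂(ν n), ∫ x, f x ∂μ, h f (hF.mono hsupp),
    fun n => hbound _ (measure_lt_top _ _),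
    hbound μ (hμ.2 _ Metric.isOpen_thickening.measurableSet hF)⟩

/-- The closed thickenings of a closed set shrink to it, and small ones have finite mass, so
continuity from above gives one of mass below `u`. -/
theorem MTendsto.eventually_real_lt (h : MTendsto C₀ ν l μ) (hμ : IsMMeasure C₀ μ)
    [∀ n, IsFiniteMeasure (ν n)] {F : Set X} (hFc : IsClosed F) (hF : BoundedAway F C₀)
    {u : ℝ} (hu : μ.real F < u) : ∀ᶠ n in l, (ν n).real F < u := by
  obtain ⟨δ₀, hδ₀, hFδ⟩ := hF.exists_thickening
  have hfin : ∀ {δ}, δ ≤ δ₀ → μ (Metric.thickening δ F) < ∞ := fun hδ =>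
    hμ.2 _ Metric.isOpen_thickening.measurableSet (hFδ.mono (Metric.thickening_mono hδ F))
  have hlim := tendsto_measure_cthickening_of_isClosed (μ := μ)
    ⟨δ₀ / 2, half_pos hδ₀, ((measure_mono (Metric.cthickening_subset_thickening' hδ₀
      (half_lt_self hδ₀) F)).trans_lt (hfin le_rfl)).ne⟩ hFc
  have hFfin : μ F < ∞ :=
    (measure_mono (Metric.self_subset_thickening hδ₀ F)).trans_lt (hfin le_rfl)
  have hu0 : 0 < u := measureReal_nonneg.trans_lt hu
  have hu' : μ F < ENNReal.ofReal u := (ENNReal.lt_ofReal_iff_toReal_lt hFfin.ne).2 hu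
  have hev : ∀ᶠ r in 𝓝[>] (0 : ℝ), μ (Metric.cthickening r F) < ENNReal.ofReal u :=
    (hlim.eventually (gt_mem_nhds hu')).filter_mono nhdsWithin_le_nhds
  obtain ⟨r, hr1, hr2, hr0⟩ := (hev.and (((gt_mem_nhds hδ₀).filter_mono nhdsWithin_le_nhds).and
    self_mem_nhdsWithin)).exists
  obtain ⟨a, a₀, ha, hν, -, ha₀⟩ := h.exists_real_tendsto hμ hr0
    (hFδ.mono (Metric.thickening_mono (le_of_lt hr2) F))
  have h1 : a₀ < u := by
    refine ha₀.trans_lt ?_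
    refine (ENNReal.lt_ofReal_iff_toReal_lt (hfin (le_of_lt hr2)).ne).1 ?_
    exact (measure_mono (Metric.thickening_subset_cthickening r F)).trans_lt hr1
  filter_upwards [ha.eventually (gt_mem_nhds h1)] with n hn
  exact (hν n).1.trans_lt hn

theorem MTendsto.eventually_lt_real_thickening (h : MTendsto C₀ ν l μ) (hμ : IsMMeasure C₀ μ)
    [∀ n, IsFiniteMeasure (ν n)] {F : Set X} {δ : ℝ} (hδ : 0 < δ)
    (hF : BoundedAway (Metric.thickening δ F) C₀) {u : ℝ} (hu : u < μ.real F) :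
    ∀ᶠ n in l, u < (ν n).real (Metric.thickening δ F) := by
  obtain ⟨a, a₀, ha, hν, ha₀, -⟩ := h.exists_real_tendsto hμ hδ hF
  filter_upwards [ha.eventually (lt_mem_nhds (hu.trans_le ha₀))] with n hn
  exact hn.trans_le (hν n).2

end MConvergence

/-! ### Consequences of multivariate regular variation under the canonical scaling. -/

section RegularVariation

variable {Ω : Type*} [MeasurableSpace Ω] {P : Measure Ω} {d : ℕ}
  {V : Ω → Fin d → ℝ≥0} {i : Fin d} {α : ℝ} {μ : Measure (Fin d → ℝ≥0)}

theorem isClosed_le_orderStat (i : Fin d) (y : ℝ≥0) :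
    IsClosed {v : Fin d → ℝ≥0 | y ≤ orderStat v i} :=
  isClosed_le continuous_const (continuous_orderStat i)

theorem boundedAway_le_orderStat (i : Fin d) {y : ℝ≥0} (hy : 0 < y) :
    BoundedAway {v : Fin d → ℝ≥0 | y ≤ orderStat v i} (coordPlanes i) :=
  boundedAway_coordPlanes_iff.2 ⟨y, hy, subset_rfl⟩

theorem IsMMeasure.measure_le_orderStat_lt_top (hμ : IsMMeasure (coordPlanes i) μ) {y : ℝ≥0}
    (hy : 0 < y) : μ {v | y ≤ orderStat v i} < ∞ :=
  hμ.2 _ (isClosed_le_orderStat i y).measurableSet (boundedAway_le_orderStat i hy)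

theorem IsMMeasure.exists_measureReal_le_orderStat_lt (hμ : IsMMeasure (coordPlanes i) μ)
    {ε : ℝ} (hε : 0 < ε) : ∃ y : ℝ≥0, 0 < y ∧ μ.real {v | y ≤ orderStat v i} < ε := by
  set s : ℕ → Set (Fin d → ℝ≥0) := fun n => {v | (n + 1 : ℝ≥0) ≤ orderStat v i} with hs
  have hpos : ∀ n : ℕ, (0 : ℝ≥0) < n + 1 := fun n => by positivity
  have hanti : Antitone s := fun m n hmn v (hv : (n + 1 : ℝ≥0) ≤ _) =>
    le_trans (by gcongr) hv
  have hlim := tendsto_measure_iInter_atTop (μ := μ) (s := s)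
    (fun n => (isClosed_le_orderStat i _).measurableSet.nullMeasurableSet) hanti
    ⟨0, (hμ.measure_le_orderStat_lt_top (hpos 0)).ne⟩
  have hempty : ⋂ n, s n = ∅ := by
    refine Set.eq_empty_iff_forall_notMem.2 fun v hv => ?_
    obtain ⟨n, hn⟩ := exists_nat_gt (orderStat v i)
    have : (n + 1 : ℝ≥0) ≤ orderStat v i := Set.mem_iInter.1 hv n
    exact (hn.trans (lt_add_of_pos_right _ zero_lt_one)).not_ge this
  rw [hempty, measure_empty] at hlim
  obtain ⟨n, hn⟩ := (hlim.eventually (gt_mem_nhds (ENNReal.ofReal_pos.2 hε))).exists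
  exact ⟨n + 1, hpos n, (ENNReal.lt_ofReal_iff_toReal_lt
    (hμ.measure_le_orderStat_lt_top (hpos n)).ne).1 hn⟩

theorem measureReal_smul_map (hV : Measurable V) (s c : ℝ≥0) {B : Set (Fin d → ℝ≥0)}
    (hB : MeasurableSet B) :
    (s • P.map (fun ω => c • V ω)).real B = s * P.real {ω | c • V ω ∈ B} := by
  have hm : Measurable fun ω => c • V ω := hV.const_smul c
  rw [measureReal_nnreal_smul_apply, map_measureReal_apply hm hB]
  rfl

theorem lt_orderStat_inv_smul_iff {c : ℝ≥0} (hc : 0 < c) (y : ℝ≥0) (v : Fin d → ℝ≥0) :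
    y < orderStat (c⁻¹ • v) i ↔ y * c < orderStat v i := by
  rw [orderStat_smul, inv_mul_eq_div, lt_div_iff₀ hc]

/-- Vectors which a contraction by a factor between `l` and `1` moves into `F`. -/
def dilate (l : ℝ≥0) (F : Set (Fin d → ℝ≥0)) : Set (Fin d → ℝ≥0) :=
  {v | ∃ c ∈ Set.Icc l 1, c • v ∈ F}

/-- The set is a projection along the compact interval `[l, 1]`, and such projections are closed
maps. -/
theorem isClosed_dilate (l : ℝ≥0) {F : Set (Fin d → ℝ≥0)} (hF : IsClosed F) :
    IsClosed (dilate l F) := by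
  have hS : IsClosed {p : Set.Icc l 1 × (Fin d → ℝ≥0) | (p.1 : ℝ≥0) • p.2 ∈ F} :=
    hF.preimage ((continuous_subtype_val.comp continuous_fst).smul continuous_snd)
  convert isClosedMap_snd_of_compactSpace _ hS using 1
  ext v
  simp [dilate]

theorem iInter_dilate {u : ℕ → ℝ≥0} (hu : ∀ n, u n ≤ 1)
    (hlim : Tendsto u atTop (𝓝 1)) {F : Set (Fin d → ℝ≥0)} (hF : IsClosed F) :
    ⋂ n, dilate (u n) F = F := by
  refine Set.Subset.antisymm (fun v hv => ?_) fun v hv => Set.mem_iInter.2 fun n =>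
    ⟨1, ⟨hu n, le_rfl⟩, by rwa [one_smul]⟩
  choose c hc hcv using Set.mem_iInter.1 hv
  have hclim : Tendsto c atTop (𝓝 1) :=
    tendsto_of_tendsto_of_tendsto_of_le_of_le hlim tendsto_const_nhds
      (fun n => (hc n).1) fun n => (hc n).2
  have h1 : Tendsto (fun n => c n • v) atTop (𝓝 ((1 : ℝ≥0) • v)) :=
    hclim.smul_const v
  rw [one_smul] at h1
  exact hF.mem_of_tendsto h1 (Eventually.of_forall hcv)

namespace MRV

theorem exists_unbounded (h : MRV P V α (canonicalScaling P V i) μ (coordPlanes i)) (M : ℝ≥0) :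
    ∃ s, 1 < s ∧ M < canonicalScaling P V i s := by
  rcases h.1.eq_or_lt' with h0 | h0
  · exact IsTailQuantile.unbounded_of_isRVTop (h.2.2.1 h0) M
  · exact IsTailQuantile.unbounded_of_isRV (one_div_pos.2 h0) (h.2.1 h0) M

variable [IsProbabilityMeasure P]

theorem tail_pos (h : MRV P V α (canonicalScaling P V i) μ (coordPlanes i))
    (hV : Measurable V) (t : ℝ≥0) : 0 < tail P V i t :=
  (isTailQuantile_canonicalScaling P hV i).tail_pos_of_unbounded h.exists_unbounded t

/-- If `α = 0`, rapid variation gives `b (2 s) > y * b s`, hence `s * T (y * b s) > 1 / 2` for large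
`s` and every `y`. The limit measure would then keep mass at least `1 / 2` arbitrarily far out,
against its finiteness. -/
theorem index_pos (h : MRV P V α (canonicalScaling P V i) μ (coordPlanes i))
    (hV : Measurable V) : 0 < α := by
  refine h.1.lt_of_ne' fun h0 => ?_
  have hq := isTailQuantile_canonicalScaling P hV i
  have hμ := h.2.2.2.1
  obtain ⟨y, hy, hyμ⟩ := hμ.exists_measureReal_le_orderStat_lt (ε := 1 / 2) (by norm_num)
  have hev := h.2.2.2.2.2.eventually_real_lt hμ (isClosed_le_orderStat i y)
    (boundedAway_le_orderStat i hy) hyμ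
  obtain ⟨s, h1, h2, h3, h4⟩ := (hev.and ((((h.2.2.1 h0).1 2 one_lt_two).eventually_gt_atTop
    y).and ((eventually_gt_atTop 1).and ((hq.tendsto_scale (h.tail_pos hV)).eventually_gt_atTop
    0)))).exists
  rw [measureReal_smul_map hV _ _ (isClosed_le_orderStat i y).measurableSet] at h1
  rw [lt_div_iff₀ h4] at h2
  have h5 := mt (hq.le_iff _ (h3.trans (lt_mul_of_one_lt_right (zero_lt_one.trans h3)
    one_lt_two)) _).2 h2.not_ge
  rw [not_le, ← NNReal.coe_lt_coe, coe_tail] at h5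
  have h6 : P.real {ω | y * canonicalScaling P V i s < orderStat (V ω) i}
      ≤ P.real {ω | (canonicalScaling P V i s)⁻¹ • V ω ∈ {v | y ≤ orderStat v i}} :=
    measureReal_mono fun ω hω => ((lt_orderStat_inv_smul_iff h4 y (V ω)).2 hω).le
  have hs0 : (0 : ℝ) < s := by exact_mod_cast zero_lt_one.trans h3
  have h7 : (s : ℝ) * ((s * 2 : ℝ≥0)⁻¹ : ℝ≥0) = 1 / 2 := by
    push_cast
    field_simp
  have h8 := mul_lt_mul_of_pos_left (h5.trans_le h6) hs0
  linarith

theorem isRV (h : MRV P V α (canonicalScaling P V i) μ (coordPlanes i)) (hV : Measurable V) :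
    IsRV (canonicalScaling P V i) (1 / α) := h.2.1 (h.index_pos hV)

/-- An upper bound suffices for the normalization of `μ`: `tendsto_measureReal_div_tail` obtains its
lower estimate by taking complements. -/
theorem measureReal_le_orderStat_le
    (h : MRV P V α (canonicalScaling P V i) μ (coordPlanes i)) (hV : Measurable V)
    {y : ℝ≥0} (hy : 0 < y) : μ.real {v | y ≤ orderStat v i} ≤ (y ^ (-α) : ℝ≥0) := by
  by_contra! hlt
  have hq := isTailQuantile_canonicalScaling P hV i
  have hμ := h.2.2.2.1
  have hlt' : y ^ (-α) < (μ.real {v | y ≤ orderStat v i}).toNNReal := by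
    rwa [Real.lt_toNNReal_iff_coe_lt]
  obtain ⟨u, hu1, hu2⟩ := exists_between hlt'
  rw [Real.lt_toNNReal_iff_coe_lt] at hu2
  have hcont : ContinuousAt (fun x : ℝ≥0 => x ^ (-α)) y :=
    NNReal.continuousAt_rpow_const (Or.inl hy.ne')
  have hev : ∀ᶠ a in 𝓝[<] y, a ^ (-α) < u ∧ 0 < a :=
    (((hcont.eventually (gt_mem_nhds hu1)).and (lt_mem_nhds hy))).filter_mono nhdsWithin_le_nhds
  have : (𝓝[<] y).NeBot := nhdsLT_neBot_of_exists_lt ⟨0, hy⟩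
  obtain ⟨a, ⟨ha1, ha0⟩, hay⟩ := (hev.and self_mem_nhdsWithin).exists
  have hay' : (0 : ℝ) < y - a := sub_pos.2 (NNReal.coe_lt_coe.2 hay)
  have hsub : Metric.thickening (y - a : ℝ) {v : Fin d → ℝ≥0 | y ≤ orderStat v i}
      ⊆ {v | a < orderStat v i} := by
    intro v hv
    obtain ⟨w, hw, hvw⟩ := Metric.mem_thickening_iff.1 hv
    have h1 := orderStat_le_add_nndist w v i
    rw [← NNReal.coe_le_coe, NNReal.coe_add, coe_nndist, dist_comm] at h1
    have h2 : (y : ℝ) ≤ (orderStat w i : ℝ≥0) := NNReal.coe_le_coe.2 hw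
    rw [Set.mem_ofPred_eq, ← NNReal.coe_lt_coe]
    linarith
  have hev1 := h.2.2.2.2.2.eventually_lt_real_thickening hμ hay'
    ((boundedAway_le_orderStat i ha0).mono fun v hv => le_of_lt (show a < orderStat v i from hsub hv)) hu2
  obtain ⟨s, h1, h2, h4⟩ := (hev1.and ((hq.eventually_mul_tail_lt (h.tail_pos hV)
    (h.index_pos hV) (h.isRV hV) ha0 ha1).and
    ((hq.tendsto_scale (h.tail_pos hV)).eventually_gt_atTop 0))).exists
  rw [measureReal_smul_map hV _ _ Metric.isOpen_thickening.measurableSet] at h1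
  rw [← NNReal.coe_lt_coe, NNReal.coe_mul, coe_tail] at h2
  refine (h1.trans_le (mul_le_mul_of_nonneg_left (measureReal_mono fun ω hω => ?_)
    (NNReal.coe_nonneg s))).not_gt h2
  exact (lt_orderStat_inv_smul_iff h4 a (V ω)).1 (hsub hω)

/-- With `s = 1 / T t` and `c = b s / t`, the vector `V / t` equals `c • (V / b s)`, where
eventually `c ∈ [l, 1]`. So `V / t ∈ F` forces `V / b s ∈ dilate l F`, and these closed sets
decrease to `F` as `l` increases to `1`. -/
theorem eventually_measureReal_le
    (h : MRV P V α (canonicalScaling P V i) μ (coordPlanes i)) (hV : Measurable V)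
    {F : Set (Fin d → ℝ≥0)} (hF : IsClosed F) {δ : ℝ≥0} (hδ : 0 < δ)
    (hFδ : F ⊆ {v | δ ≤ orderStat v i}) {u : ℝ} (hu : μ.real F < u) :
    ∀ᶠ t in atTop, P.real {ω | t⁻¹ • V ω ∈ F} ≤ u * tail P V i t := by
  have hq := isTailQuantile_canonicalScaling P hV i
  have hμ := h.2.2.2.1
  have hs := hq.tendsto_inv_tail (h.tail_pos hV)
  have hsub : ∀ l, dilate l F ⊆ {v | δ ≤ orderStat v i} := by
    rintro l v ⟨c, hc, hcv⟩
    have h1 : δ ≤ orderStat (c • v) i := hFδ hcv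
    rw [orderStat_smul] at h1
    exact h1.trans (mul_le_of_le_one_left zero_le hc.2)
  obtain ⟨l, hlmono, hlmem, hllim⟩ := exists_seq_strictMono_tendsto' (zero_lt_one (α := ℝ≥0))
  have hlim := tendsto_measure_iInter_atTop (μ := μ) (s := fun n => dilate (l n) F)
    (fun n => (isClosed_dilate _ hF).measurableSet.nullMeasurableSet)
    (fun m n hmn v ⟨c, hc, hcv⟩ => ⟨c, ⟨(hlmono.monotone hmn).trans hc.1, hc.2⟩, hcv⟩)
    ⟨0, ((measure_mono (hsub _)).trans_lt (hμ.measure_le_orderStat_lt_top hδ)).ne⟩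
  rw [iInter_dilate (fun n => (hlmem n).2.le) hllim hF] at hlim
  have hu' : μ F < ENNReal.ofReal u := (ENNReal.lt_ofReal_iff_toReal_lt
    ((measure_mono hFδ).trans_lt (hμ.measure_le_orderStat_lt_top hδ)).ne).2 hu
  obtain ⟨n, hn⟩ := (hlim.eventually (gt_mem_nhds hu')).exists
  have hn' : μ.real (dilate (l n) F) < u := (ENNReal.lt_ofReal_iff_toReal_lt
    ((measure_mono (hsub _)).trans_lt (hμ.measure_le_orderStat_lt_top hδ)).ne).1 hn
  filter_upwards [hs.eventually (h.2.2.2.2.2.eventually_real_lt hμ (isClosed_dilate (l n) hF)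
    ((boundedAway_le_orderStat i hδ).mono (hsub _)) hn'),
    (hq.tendsto_scale_inv_tail_div (h.tail_pos hV) (h.index_pos hV) (h.isRV hV)).eventually
      (lt_mem_nhds (hlmem n).2), hq.scale_inv_tail_le (h.tail_pos hV),
    hs.eventually ((hq.tendsto_scale (h.tail_pos hV)).eventually_gt_atTop 0)] with t h1 h2 h3 h4
  rw [measureReal_smul_map hV _ _ (isClosed_dilate (l n) hF).measurableSet, NNReal.coe_inv,
    inv_mul_eq_div, div_lt_iff₀ (NNReal.coe_pos.2 (h.tail_pos hV t))] at h1
  refine (measureReal_mono fun ω hω => ?_).trans h1.le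
  refine ⟨canonicalScaling P V i (tail P V i t)⁻¹ / t, ⟨h2.le, div_le_one_of_le₀ h3 zero_le⟩, ?_⟩
  rw [smul_smul, div_mul_eq_mul_div, mul_inv_cancel₀ h4.ne', one_div]
  exact hω

theorem tendsto_measureReal_div_tail
    (h : MRV P V α (canonicalScaling P V i) μ (coordPlanes i)) (hV : Measurable V)
    {B : Set (Fin d → ℝ≥0)} (hB : MeasurableSet B) {δ : ℝ≥0} (hδ : 0 < δ)
    (hBδ : B ⊆ {v | δ ≤ orderStat v i}) (hfr : μ (frontier B) = 0) :
    Tendsto (fun t => P.real {ω | t⁻¹ • V ω ∈ B} / tail P V i t) atTop (𝓝 (μ.real B)) := by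
  have hq := isTailQuantile_canonicalScaling P hV i
  have hμ := h.2.2.2.1
  have hT : ∀ t, (0 : ℝ) < tail P V i t := fun t => NNReal.coe_pos.2 (h.tail_pos hV t)
  set U : Set (Fin d → ℝ≥0) := {v | δ ≤ orderStat v i} with hU
  have hUc : IsClosed U := isClosed_le_orderStat i δ
  have hUfin : μ U < ∞ := hμ.measure_le_orderStat_lt_top hδ
  refine tendsto_order.2 ⟨fun l hl => ?_, fun u hu => ?_⟩
  -- The lower bound comes from the upper bound for the complement of `B` in `U`: the tail at `δ *
  -- t` is about `δ ^ (-α) * T t`, and the part falling in `G` accounts for at most `δ ^ (-α) - μ B`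
  -- of it.
  · set G := closure (U \ B) with hG
    have hGU : G ⊆ U := closure_minimal Set.sdiff_subset hUc
    have hGsub : G ⊆ (U \ B) ∪ frontier B := by
      intro v hv
      by_cases hvB : v ∈ B
      · refine Or.inr ?_
        rw [frontier_eq_closure_inter_closure]
        exact ⟨subset_closure hvB, closure_mono (fun w hw => hw.2) hv⟩
      · exact Or.inl ⟨hGU hv, hvB⟩
    have hUB : μ (U \ B) < ∞ := (measure_mono Set.sdiff_subset).trans_lt hUfin
    have hμG : μ.real G ≤ (δ ^ (-α) : ℝ≥0) - μ.real B := by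
      have h1 : μ.real G ≤ μ.real (U \ B) := by
        refine ENNReal.toReal_mono hUB.ne ?_
        refine (measure_mono hGsub).trans ((measure_union_le _ _).trans ?_)
        rw [hfr, add_zero]
      have h2 : μ.real (U \ B) = μ.real U - μ.real B :=
        measureReal_sdiff hBδ hB hUfin.ne
      have h3 := h.measureReal_le_orderStat_le hV hδ
      linarith
    set e : ℝ := (μ.real B - l) / 2 with he
    have he0 : 0 < e := half_pos (sub_pos.2 hl)
    have hlim := NNReal.tendsto_coe.2
      (hq.tendsto_tail_div (h.tail_pos hV) (h.index_pos hV) (h.isRV hV) hδ)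
    filter_upwards [h.eventually_measureReal_le hV isClosed_closure hδ hGU
      (lt_add_of_pos_right _ he0), hlim.eventually (lt_mem_nhds (sub_lt_self _ he0)),
      eventually_gt_atTop 0] with t h1 h2 ht
    rw [NNReal.coe_div, lt_div_iff₀ (hT t), coe_tail P V i (δ * t)] at h2
    rw [lt_div_iff₀ (hT t)]
    have h3 : P.real {ω | δ * t < orderStat (V ω) i}
        ≤ P.real {ω | t⁻¹ • V ω ∈ B} + P.real {ω | t⁻¹ • V ω ∈ G} := by
      refine (measureReal_mono fun ω hω => ?_).trans (measureReal_union_le _ _)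
      by_cases hB' : t⁻¹ • V ω ∈ B
      · exact Or.inl hB'
      · exact Or.inr (subset_closure ⟨((lt_orderStat_inv_smul_iff ht δ (V ω)).2 hω).le, hB'⟩)
    have h4 : l * tail P V i t
        ≤ ((δ ^ (-α) : ℝ≥0) - e) * tail P V i t - (μ.real G + e) * tail P V i t := by
      rw [← sub_mul]
      refine mul_le_mul_of_nonneg_right ?_ (hT t).le
      linarith
    linarith
  · have hcl : closure B ⊆ U := closure_minimal hBδ hUc
    have hμcl : μ.real (closure B) ≤ μ.real B := by
      refine ENNReal.toReal_mono ((measure_mono hBδ).trans_lt hUfin).ne ?_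
      rw [closure_eq_self_union_frontier]
      refine (measure_union_le _ _).trans ?_
      rw [hfr, add_zero]
    obtain ⟨u', hu', huu⟩ := exists_between (lt_of_le_of_lt hμcl hu)
    filter_upwards [h.eventually_measureReal_le hV isClosed_closure hδ hcl hu'] with t h1
    refine lt_of_le_of_lt ?_ huu
    rw [div_le_iff₀ (hT t)]
    refine (measureReal_mono fun ω hω => ?_).trans h1
    exact subset_closure (show t⁻¹ • V ω ∈ B from hω)

/-- If `V / t ∈ B`, then `V^(i)` is at least `t * δ / τ`; Potter's bound with `2 ^ (n + 1)` just
above `τ / δ` applies. The constants depend on neither `τ` nor `B`, as needed for a random matrix.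
-/
theorem exists_measure_le_rpow
    (h : MRV P V α (canonicalScaling P V i) μ (coordPlanes i)) (hV : Measurable V)
    {δ : ℝ≥0} (hδ : 0 < δ) {p : ℝ} (hp : α < p) :
    ∃ K t₀ : ℝ≥0, ∀ t, t₀ ≤ t → ∀ (τ : ℝ≥0) (B : Set (Fin d → ℝ≥0)),
      B ⊆ {v | δ ≤ τ * orderStat v i} →
      P {ω | t⁻¹ • V ω ∈ B} ≤ (K * (1 + τ ^ p) * tail P V i t : ℝ≥0) := by
  have hq := isTailQuantile_canonicalScaling P hV i
  have hp0 : 0 ≤ p := ((h.index_pos hV).trans hp).le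
  obtain ⟨K, t₀, hK⟩ := hq.potter (h.tail_pos hV) (h.index_pos hV) (h.isRV hV) hp
  refine ⟨K * (2 ^ p * (1 + (δ⁻¹) ^ p)), max t₀ 1, fun t ht τ B hB => ?_⟩
  have ht0 : 0 < t := zero_lt_one.trans_le ((le_max_right _ _).trans ht)
  -- The maximum with `1` covers small `τ`, where no power of two with a natural exponent lies below
  -- `τ / δ`.
  obtain ⟨n, hn1, hn2⟩ := exists_nat_pow_near (le_max_left 1 (δ⁻¹ * τ)) (one_lt_two (α := ℝ≥0))
  have hpow : ((2 : ℝ≥0) ^ p) ^ (n + 1) ≤ 2 ^ p * (1 + δ⁻¹ ^ p) * (1 + τ ^ p) := by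
    have hmax : max 1 (δ⁻¹ * τ) ^ p ≤ (1 + δ⁻¹ ^ p) * (1 + τ ^ p) := by
      rcases max_choice 1 (δ⁻¹ * τ) with hm | hm <;> rw [hm]
      · rw [NNReal.one_rpow]
        exact one_le_mul le_self_add le_self_add
      · rw [NNReal.mul_rpow]
        exact mul_le_mul' le_add_self le_add_self
    calc ((2 : ℝ≥0) ^ p) ^ (n + 1) = 2 ^ p * (2 ^ n) ^ p := by
          rw [pow_succ', ← NNReal.rpow_natCast (2 ^ p) n, ← NNReal.rpow_mul, mul_comm p,
            NNReal.rpow_mul, NNReal.rpow_natCast]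
      _ ≤ 2 ^ p * ((1 + δ⁻¹ ^ p) * (1 + τ ^ p)) :=
          mul_le_mul_right ((NNReal.rpow_le_rpow hn1 hp0).trans hmax) _
      _ = _ := by ring
  have hsub : {ω | t⁻¹ • V ω ∈ B} ⊆ {ω | t / 2 ^ (n + 1) < orderStat (V ω) i} := by
    intro ω hω
    have h1 : δ ≤ τ * orderStat (t⁻¹ • V ω) i := hB hω
    rw [orderStat_smul] at h1
    change t / 2 ^ (n + 1) < orderStat (V ω) i
    rw [div_lt_iff₀ (by positivity)]
    have hX : 0 < orderStat (V ω) i := by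
      rw [pos_iff_ne_zero]
      intro h0
      rw [h0, mul_zero, mul_zero] at h1
      exact h1.not_gt hδ
    have h2 : t ≤ orderStat (V ω) i * (δ⁻¹ * τ) := by
      rw [show τ * (t⁻¹ * orderStat (V ω) i) = (τ * orderStat (V ω) i) / t by
        rw [div_eq_mul_inv]; ring, le_div_iff₀ ht0] at h1
      rw [show orderStat (V ω) i * (δ⁻¹ * τ) = (τ * orderStat (V ω) i) / δ by
        rw [div_eq_mul_inv]; ring, le_div_iff₀ hδ, mul_comm]
      exact h1
    refine h2.trans_lt (mul_lt_mul_of_pos_left ((le_max_right _ _).trans_lt hn2) hX)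
  refine (measure_mono hsub).trans ?_
  rw [← ennreal_coe_tail, ENNReal.coe_le_coe]
  refine (hK (n + 1) t ((le_max_left _ _).trans ht)).trans ?_
  refine mul_le_mul_left ?_ _
  rw [mul_assoc]
  exact mul_le_mul_right hpow _

end MRV

end RegularVariation

/-! ### Integrating over the random matrix. -/

section RandomMatrix

theorem IndepFun.measure_inter_prod_preimage {Ω E F : Type*} [MeasurableSpace Ω]
    [MeasurableSpace E] [MeasurableSpace F] {P : Measure Ω} [IsFiniteMeasure P]
    {A : Ω → E} {Z : Ω → F} (hA : Measurable A) (hZ : Measurable Z) (hAZ : IndepFun A Z P)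
    {M : Set E} (hM : MeasurableSet M) {S : Set (E × F)} (hS : MeasurableSet S) :
    P {ω | A ω ∈ M ∧ (A ω, Z ω) ∈ S} = ∫⁻ ω in A ⁻¹' M, P {ω' | (A ω, Z ω') ∈ S} ∂P := by
  have hS' : MeasurableSet ((Prod.fst ⁻¹' M) ∩ S) := (measurable_fst hM).inter hS
  have h1 : P {ω | A ω ∈ M ∧ (A ω, Z ω) ∈ S}
      = (P.map fun ω => (A ω, Z ω)) ((Prod.fst ⁻¹' M) ∩ S) :=
    (Measure.map_apply (hA.prodMk hZ) hS').symm
  rw [h1, (indepFun_iff_map_prod_eq_prod_map_map hA.aemeasurable hZ.aemeasurable).1 hAZ,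
    Measure.prod_apply hS', lintegral_map (measurable_measure_prodMk_left hS') hA,
    ← lintegral_indicator (hA hM)]
  refine lintegral_congr fun ω => ?_
  rw [Measure.map_apply hZ (measurable_prodMk_left hS')]
  by_cases h : A ω ∈ M
  · rw [Set.indicator_of_mem (show ω ∈ A ⁻¹' M from h)]
    congr 1
    ext ω'
    simp [h]
  · rw [Set.indicator_of_notMem (show ω ∉ A ⁻¹' M from h)]
    exact measure_mono_null (fun ω' hω' => h hω'.1) measure_empty

variable {Ω : Type*} [MeasurableSpace Ω] {P : Measure Ω} [IsProbabilityMeasure P]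
  {q d : ℕ} [NeZero d] {Z : Ω → Fin d → ℝ≥0} {A : Ω → Matrix (Fin q) (Fin d) ℝ≥0}
  {k : Fin q} {i : Fin d} {α : ℝ} {μ : Measure (Fin d → ℝ≥0)} {C : Set (Fin q → ℝ≥0)}

theorem measurableSet_indexEvent (hA : Measurable A) (k : Fin q) (i : Fin d) :
    MeasurableSet (indexEvent A k i) := hA (measurableSet_maxIndex_eq k i)

/-- Independence writes the probability as an integral over the matrix of probabilities with the
matrix frozen. These converge pointwise after division by the tail, and the Potter bound dominates
them. -/
theorem limitMass_lt_top_and_tendsto (hZ : Measurable Z) (hA : Measurable A)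
    (hAZ : IndepFun A Z P)
    (hMRV : MRV P Z α (canonicalScaling P Z i) μ (coordPlanes i))
    (hC : MeasurableSet C) (hCaway : BoundedAway C (coordPlanes k))
    (hCfrontier : ∀ᵐ ω ∂P, ω ∈ indexEvent A k i → μ (frontier (preimg (A ω) C)) = 0)
    {p : ℝ} (hp : α < p) (hmoment : ∫⁻ ω in indexEvent A k i, tau k i (A ω) ^ p ∂P < ∞) :
    limitMass P A k i μ C < ∞ ∧
      Tendsto (fun t : ℝ≥0 =>
        P ({ω | A ω *ᵥ Z ω ∈ t • C} ∩ indexEvent A k i) / tail P Z i t) atTop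
        (𝓝 (limitMass P A k i μ C)) := by
  have hp0 : 0 ≤ p := ((hMRV.index_pos hZ).trans hp).le
  have hT := hMRV.tail_pos hZ
  obtain ⟨δ, hδ, hCδ⟩ := boundedAway_coordPlanes_iff.1 hCaway
  obtain ⟨K, t₀, hK⟩ := hMRV.exists_measure_le_rpow hZ hδ hp
  set Q := P.restrict (indexEvent A k i) with hQ
  have hΩ := measurableSet_indexEvent hA k i
  have htau : ∀ ω ∈ indexEvent A k i, tau k i (A ω) < ∞ := by
    intro ω hω
    have := tau_maxIndex_lt_top k (A ω)
    rwa [show maxIndex k (A ω) = i from hω] at this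
  set G : ℝ≥0 → Ω → ℝ≥0∞ := fun t ω =>
    P {ω' | t⁻¹ • Z ω' ∈ preimg (A ω) C} / tail P Z i t with hG
  set bd : Ω → ℝ≥0∞ := fun ω => K * (1 + tau k i (A ω) ^ p) with hbd
  have hSm : ∀ t : ℝ≥0, MeasurableSet
      {x : Matrix (Fin q) (Fin d) ℝ≥0 × (Fin d → ℝ≥0) | t⁻¹ • x.2 ∈ preimg x.1 C} := by
    intro t
    have hm : Measurable fun x : Matrix (Fin q) (Fin d) ℝ≥0 × (Fin d → ℝ≥0) =>
        x.1 *ᵥ (t⁻¹ • x.2) :=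
      measurable_mulVec_uncurry.comp (measurable_fst.prodMk (measurable_snd.const_smul t⁻¹))
    exact hm hC
  have hGm : ∀ t, Measurable (G t) := by
    intro t
    have h1 := (measurable_measure_prodMk_left (ν := P.map Z) (hSm t)).comp hA
    refine Measurable.div_const ?_ _
    convert h1 using 2 with ω
    simp only [Function.comp]
    rw [Measure.map_apply hZ (measurable_prodMk_left (hSm t))]
    rfl
  have hG_bd : ∀ t, t₀ ≤ t → ∀ ω ∈ indexEvent A k i, G t ω ≤ bd ω := by
    intro t ht ω hω
    have h1 := hK t ht _ _ (preimg_subset (htau ω hω) hCδ)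
    have h2 : ((K * (1 + (tau k i (A ω)).toNNReal ^ p) : ℝ≥0) : ℝ≥0∞) = bd ω := by
      rw [ENNReal.coe_mul, ENNReal.coe_add, ENNReal.coe_one, ENNReal.coe_rpow_of_nonneg _ hp0,
        ENNReal.coe_toNNReal (htau ω hω).ne]
    refine ENNReal.div_le_of_le_mul ?_
    rw [← h2, ← ENNReal.coe_mul]
    exact h1
  have hG_le : ∀ᶠ t in atTop, ∀ᵐ ω ∂Q, G t ω ≤ bd ω := by
    filter_upwards [eventually_ge_atTop t₀] with t ht
    filter_upwards [ae_restrict_mem hΩ] with ω hω using hG_bd t ht ω hω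
  have hbd_fin : ∫⁻ ω, bd ω ∂Q ≠ ∞ := by
    rw [lintegral_const_mul' _ _ ENNReal.coe_ne_top, lintegral_add_left measurable_const]
    refine ENNReal.mul_ne_top ENNReal.coe_ne_top (ENNReal.add_ne_top.2 ⟨?_, hmoment.ne⟩)
    simp
  have hlim : ∀ᵐ ω ∂Q, Tendsto (fun t => G t ω) atTop (𝓝 (μ (preimg (A ω) C))) := by
    filter_upwards [ae_restrict_mem hΩ, ae_restrict_of_ae hCfrontier] with ω hω hfr
    have hτ := preimg_subset (htau ω hω) hCδ
    set τ := (tau k i (A ω)).toNNReal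
    -- The denominator is `τ + 1` because `τ` may be zero.
    have hsub : preimg (A ω) C ⊆ {v | δ / (τ + 1) ≤ orderStat v i} := by
      intro v hv
      change δ / (τ + 1) ≤ orderStat v i
      rw [div_le_iff₀ (by positivity), mul_comm]
      exact (hτ hv : δ ≤ τ * orderStat v i).trans (mul_le_mul_left le_self_add _)
    have hδ' : 0 < δ / (τ + 1) := by positivity
    have h1 := hMRV.tendsto_measureReal_div_tail hZ (measurableSet_preimg (A ω) hC) hδ' hsub
      (hfr hω)
    have hfin : μ (preimg (A ω) C) ≠ ∞ := ((measure_mono hsub).trans_lt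
      (hMRV.2.2.2.1.measure_le_orderStat_lt_top hδ')).ne
    have h2 := ENNReal.tendsto_ofReal h1
    rw [ofReal_measureReal hfin] at h2
    refine h2.congr fun t => ?_
    rw [ENNReal.ofReal_div_of_pos (NNReal.coe_pos.2 (hT t)), ofReal_measureReal,
      ENNReal.ofReal_coe_nnreal]
  -- The dominating function also bounds the pointwise limit, which makes `limitMass` finite.
  have hle : ∀ᵐ ω ∂Q, μ (preimg (A ω) C) ≤ bd ω := by
    filter_upwards [ae_restrict_mem hΩ, hlim] with ω hω hl
    refine le_of_tendsto hl ?_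
    filter_upwards [eventually_ge_atTop t₀] with t ht using hG_bd t ht ω hω
  refine ⟨(lintegral_mono_ae hle).trans_lt hbd_fin.lt_top, ?_⟩
  have hdom := tendsto_lintegral_filter_of_dominated_convergence (μ := Q) bd
    (Eventually.of_forall hGm) hG_le hbd_fin hlim
  refine hdom.congr' ?_
  filter_upwards [eventually_gt_atTop 0] with t ht
  simp only [hG, div_eq_mul_inv]
  rw [lintegral_mul_const' _ _ (ENNReal.inv_ne_top.2 (ENNReal.coe_ne_zero.2 (hT t).ne'))]
  congr 1
  refine (IndepFun.measure_inter_prod_preimage hA hZ hAZ (measurableSet_maxIndex_eq k i)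
    (hSm t)).symm.trans (congrArg P ?_)
  ext ω
  exact and_comm.trans (and_congr_left fun _ =>
    (mulVec_mem_smul_iff (A ω) C ht.ne' (Z ω)).symm)

theorem measureReal_eq_sum_indexEvent (hA : Measurable A) (k : Fin q) {S : Set Ω} :
    P.real S = ∑ i, P.real (S ∩ indexEvent A k i) := by
  have h := measureReal_biUnion_finset (μ := P.restrict S) (s := Finset.univ)
    (f := indexEvent A k) (fun i _ j _ hij => Set.disjoint_left.2 fun ω hi hj =>
      hij ((show maxIndex k (A ω) = i from hi).symm.trans hj))
    fun i _ => measurableSet_indexEvent hA k i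
  have hU : ⋃ i ∈ (Finset.univ : Finset (Fin d)), indexEvent A k i = Set.univ := by
    refine Set.eq_univ_of_forall fun ω => ?_
    simp only [Finset.mem_univ, Set.iUnion_true, Set.mem_iUnion]
    exact ⟨maxIndex k (A ω), rfl⟩
  rw [hU, measureReal_restrict_apply_univ] at h
  rw [h]
  refine Finset.sum_congr rfl fun i _ => ?_
  rw [measureReal_restrict_apply (measurableSet_indexEvent hA k i), Set.inter_comm]

end RandomMatrix

/-! ### Comparing tails of different order statistics. -/

section TailComparison

variable {Ω : Type*} [MeasurableSpace Ω] {P : Measure Ω} [IsProbabilityMeasure P]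
  {d : ℕ} {Z : Ω → Fin d → ℝ≥0} {α : Fin d → ℝ} {μ : Fin d → Measure (Fin d → ℝ≥0)}

/-- Only the step from `i` to its successor needs the scaling condition; beyond it, tails decrease
with the index. -/
theorem tendsto_tail_div_tail_of_lt (hZ : Measurable Z)
    (hMRV : ∀ i, MRV P Z (α i) (canonicalScaling P Z i) (μ i) (coordPlanes i))
    (hscale : ∀ i j : Fin d, (i : ℕ) + 1 = (j : ℕ) →
      Tendsto (fun t => canonicalScaling P Z i t / canonicalScaling P Z j t) atTop atTop)
    {i j : Fin d} (hij : i < j) :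
    Tendsto (fun t => tail P Z j t / tail P Z i t) atTop (𝓝 0) := by
  set m : Fin d := ⟨i + 1, by omega⟩ with hm
  have hmj : m ≤ j := Fin.le_def.2 (by simp only [hm]; omega)
  have h := (isTailQuantile_canonicalScaling P hZ i).tendsto_tail_div_tail
    ((hMRV i).tail_pos hZ) (isTailQuantile_canonicalScaling P hZ m) ((hMRV m).tail_pos hZ)
    ((hMRV m).index_pos hZ) ((hMRV m).isRV hZ) (hscale i m rfl)
  refine tendsto_of_tendsto_of_tendsto_of_le_of_le tendsto_const_nhds h (fun _ => zero_le)
    fun t => ?_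
  change tail P Z j t / tail P Z i t ≤ tail P Z m t / tail P Z i t
  gcongr
  exact tail_mono_index P Z hmj t

end TailComparison

end HiddenRV

end

/-! ### Assembling the contributions of all indices. -/

theorem mainTheorem3 {Ω : Type*} [MeasurableSpace Ω] (P : Measure Ω) [IsProbabilityMeasure P]
    {q d : ℕ} [NeZero d]
    (Z : Ω → Fin d → ℝ≥0) (hZ : Measurable Z)
    (A : Ω → Matrix (Fin q) (Fin d) ℝ≥0) (hA : Measurable A)
    (hAZ : IndepFun A Z P)
    (hrows : ∀ᵐ ω ∂P, ∀ r : Fin q, (A ω).row r ≠ 0)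
    (α : Fin d → ℝ) (μ : Fin d → Measure (Fin d → ℝ≥0))
    (hMRV : ∀ i, MRV P Z (α i) (canonicalScaling P Z i) (μ i) (coordPlanes i))
    (hscale : ∀ i j : Fin d, (i : ℕ) + 1 = (j : ℕ) →
      Tendsto (fun t => canonicalScaling P Z i t / canonicalScaling P Z j t) atTop atTop)
    (k : Fin q) (C : Set (Fin q → ℝ≥0)) (hC : MeasurableSet C)
    (hCsub : C ⊆ subcone k) (hCaway : BoundedAway C (coordPlanes k))
    (hCfrontier : ∀ i, ∀ᵐ ω ∂P, ω ∈ indexEvent A k i → μ i (frontier (preimg (A ω) C)) = 0)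
    (hmoment : ∀ i, ∃ δ : ℝ, 0 < δ ∧
      ∫⁻ ω in indexEvent A k i, tau k i (A ω) ^ (α i + δ) ∂P < ∞)
    (hfaces : ∀ (i : Fin d) (J : Finset (Fin d)), J.card = (i : ℕ) + 1 → 0 < μ i (openFace J))
    (hempty : ∀ i, iStar P A k ≤ i → i < iotaBar P A k μ C →
      ∀ ω ∈ indexEvent A k i, preimg (A ω) C = ∅) :
    limitMass P A k (iotaBar P A k μ C) (μ (iotaBar P A k μ C)) C < ∞ ∧
    (fun t : ℝ≥0 => P.real {ω | A ω *ᵥ Z ω ∈ t • C} -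
        P.real {ω | t < orderStat (Z ω) (iotaBar P A k μ C)} *
          (limitMass P A k (iotaBar P A k μ C) (μ (iotaBar P A k μ C)) C).toReal)
      =o[atTop] fun t : ℝ≥0 => P.real {ω | t < orderStat (Z ω) (iotaBar P A k μ C)} := by 
  set ι := iotaBar P A k μ C with hι
  have hT : ∀ i t, (0 : ℝ) < tail P Z i t := fun i t => NNReal.coe_pos.2 ((hMRV i).tail_pos hZ t)
  have hmain : ∀ i, limitMass P A k i (μ i) C < ∞ ∧ Tendsto (fun t : ℝ≥0 =>
      P ({ω | A ω *ᵥ Z ω ∈ t • C} ∩ indexEvent A k i) / tail P Z i t) atTop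
        (𝓝 (limitMass P A k i (μ i) C)) := by
    intro i
    obtain ⟨δ, hδ, hδm⟩ := hmoment i
    exact limitMass_lt_top_and_tendsto hZ hA hAZ (hMRV i) hC hCaway (hCfrontier i)
      (lt_add_of_pos_right _ hδ) hδm
  have hreal : ∀ i, Tendsto (fun t : ℝ≥0 =>
      P.real ({ω | A ω *ᵥ Z ω ∈ t • C} ∩ indexEvent A k i) / tail P Z i t) atTop
        (𝓝 (limitMass P A k i (μ i) C).toReal) := by
    intro i
    refine ((ENNReal.tendsto_toReal (hmain i).1.ne).comp (hmain i).2).congr fun t => ?_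
    simp only [Function.comp]
    rw [ENNReal.toReal_div, ENNReal.coe_toReal, Measure.real]
  refine ⟨(hmain ι).1, ?_⟩
  have hterm : ∀ i, Tendsto (fun t : ℝ≥0 =>
      P.real ({ω | A ω *ᵥ Z ω ∈ t • C} ∩ indexEvent A k i) / tail P Z ι t) atTop
        (𝓝 (if i = ι then (limitMass P A k ι (μ ι) C).toReal else 0)) := by
    intro i
    rcases lt_trichotomy i ι with hi | rfl | hi
    · rw [if_neg hi.ne]
      refine tendsto_const_nhds.congr' ?_
      filter_upwards [eventually_gt_atTop 0] with t ht
      have h0 : P.real ({ω | A ω *ᵥ Z ω ∈ t • C} ∩ indexEvent A k i) = 0 := by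
        rcases lt_or_ge i (iStar P A k) with h | h
        · have h1 : P (indexEvent A k i) = 0 := by
            by_contra hne
            exact h.not_ge (csInf_le (Set.toFinite _).bddBelow (pos_iff_ne_zero.2 hne))
          rw [measureReal_eq_zero_iff]
          exact measure_mono_null Set.inter_subset_right h1
        · rw [measureReal_eq_zero_iff]
          refine measure_mono_null (t := ∅) ?_ measure_empty
          rintro ω ⟨h1, h2⟩
          have h3 := (mulVec_mem_smul_iff (A ω) C ht.ne' (Z ω)).1 h1
          rw [hempty i h hi ω h2] at h3
          exact h3
      rw [h0, zero_div]
    · rw [if_pos rfl]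
      exact hreal ι
    · rw [if_neg hi.ne']
      -- The contribution is of the order of the tail at `i` at most, which is negligible against
      -- the tail at `ι`.
      have h1 := (hreal i).mul (NNReal.tendsto_coe.2
        (tendsto_tail_div_tail_of_lt hZ hMRV hscale hi))
      rw [NNReal.coe_zero, mul_zero] at h1
      refine h1.congr fun t => ?_
      rw [NNReal.coe_div, div_mul_div_cancel₀ (hT i t).ne']
  have hsum := tendsto_finsetSum Finset.univ fun i (_ : i ∈ Finset.univ) => hterm i
  rw [Finset.sum_ite_eq' Finset.univ ι, if_pos (Finset.mem_univ _)] at hsum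
  refine (isLittleO_iff_tendsto fun t ht => absurd ht (hT ι t).ne').2 ?_
  have h2 := hsum.sub_const (limitMass P A k ι (μ ι) C).toReal
  rw [sub_self] at h2
  refine h2.congr fun t => ?_
  rw [← coe_tail, sub_div, mul_div_cancel_left₀ _ (hT ι t).ne',
    measureReal_eq_sum_indexEvent hA k, Finset.sum_div]
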